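/- **Theorem 4.** Let $S,E$ be finite-dimensional systems, $|\varphi^0\rangle,|\varphi^1\rangle$ unit vectors of $SE$, and $$|\psi\rangle_{ABSE}=\tfrac1{\sqrt2}\sum_{k\in\{0,1\}}|kk\rangle_{AB}|\varphi^k\rangle_{SE},\qquad A,B\text{ qubits}.$$ Write $|\widetilde x\rangle=(|0\rangle+(-1)^x|1\rangle)/\sqrt2$, extended to bit strings by tensor products, and let $\chi(\mathcal E)=S\big(\tfrac12\sum_x\rho^x\big)-\tfrac12\sum_xS(\rho^x)$ (von Neumann entropies, base $2$) be the Holevo quantity of $\mathcal E=\{\tfrac12,\rho^x_{BS}\}_{x=0,1}$, $\rho^x_{BS}=2\,{}_A\langle\widetilde x|\psi_{ABS}|\widetilde x\rangle_A$; put $\rho=\tfrac12(\rho^0+\rho^1)$. *Protocol* for $n$ copies, with parameters $r\le n$, $m=n-r$, $\delta>0$. Let $u_1,\dots,u_m\in\mathbb F_2^n$ be linearly independent. Choose any linear bijection $c:\mathbb F_2^n\to\mathbb F_2^r\times\mathbb F_2^m$ with $c^{-1}(0,e_i)=u_i$, and decompose Alice's $n$ qubits as $A=A_1A_2$ and Bob's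 as $B=B_1B_2$ by $|k\rangle=|\ell\rangle|\mathbf m\rangle$ for $c(k)=(\ell,\mathbf m)$. Alice measures the observables $X^{u_1},\dots,X^{u_m}$ (i.e. $A_2$ in the $x$-basis) and announces the outcome $h\in\mathbb F_2^m$; this is the linear hash $h_i=u_i\cdot x$ of the outcome $x$ of an $x$-basis measurement of all her qubits. Bob applies $Z^h$ to $B_2$. The result is the normalized vector $|\Psi'\rangle\propto{}_{A_2}\langle\widetilde h|Z^h_{B_2}|\psi\rangle^{\otimes n}$ on $A_1B_1(B_2S^n)E^n$, in which $B_2S^n$ is the shield. With $\varrho^y=2^r\,{}_{A_1}\langle\widetilde y|\Psi'_{A_1BS^n}|\widetilde y\rangle_{A_1}$, let $\Pi^y$ be the projection onto the eigenvectors of $\varrho^y$ with eigenvalues in $[2^{-n(s+\delta)},2^{-n(s-\delta)}]$, $s=\tfrac12\sum_xS(\rho^x)$, let $\Pi$ be the corresponding projection for $\rho^{\otimes n}$ with $s=S(\rho)$, and let $$E^y=T^{-1/2}\,\Pi\Pi^y\Pi\,T^{-1/2},\qquad T=\sum_{y\in\mathbb F_2^r}\Pi\Pi^y\Pi$$ (inverse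 on the support) be Bob's pretty good measurement. An untwisting operator for it is the adjoint of a unitary $U=\sum_{\ell}|\ell\rangle\langle\ell|_{B_1}\otimes V^\ell_{B_2S^n}$ ($V^\ell$ unitary) with $E^y=Q\,U(|\widetilde y\rangle\langle\widetilde y|_{B_1}\otimes 1)U^\dagger Q$ for all $y$, where $Q=\sum_yE^y$. Call $(u_i)$ *$\varepsilon$-good* if for every such $c$ and every announcement $h$: 1. $2^{-r}\sum_y\operatorname{Tr}[\varrho^yE^y]\ge1-\varepsilon$; 2. there are an untwisting operator $U^\dagger$ for $(E^y)$ as above and a unit vector $|\xi\rangle_{(B_2S^n)E^n}$ such that $\big\||\Psi'\rangle\langle\Psi'|-|\gamma\rangle\langle\gamma|\big\|_1\le2\varepsilon$ for the $r$-bit private state $|\gamma\rangle=2^{-r/2}\sum_{k\in\mathbb F_2^r}|kk\rangle_{A_1B_1}V^k|\xi\rangle$; 3. measuring $A_1$ and $B_1$ of $\Psi'$ in the standard basis and discarding the shield gives a state within trace-norm distance $2\varepsilon$ of a perfect secret key $\big(2^{-r}\sum_k|k\rangle\langle k|\otimes|k\rangle\langle k|\big)\otimes\rho_{E}$ for some density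 operator $\rho_E$ of $E^n$. *Claim.* There are integers $0\le r_n\le n$ with $r_n/n\to\chi(\mathcal E)$, and $\delta_n>0$, $\varepsilon_n$ with $\delta_n\to0$, $\varepsilon_n\to0$, such that for every $n$, when $(u_1,\dots,u_{n-r_n})$ is chosen uniformly among the linearly independent families in $\mathbb F_2^n$, it is $\varepsilon_n$-good (with $r=r_n$, $\delta=\delta_n$) with probability at least $1-\varepsilon_n$. -/

import Mathlib

open scoped Matrix Kronecker ComplexOrder

noncomputable section

namespace PrivateState

/-- Bit strings of length `n`, as vectors over the field with two elements. -/
abbrev Bits (n : ℕ) : Type := Fin n → ZMod 2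

/-! ### Finite-dimensional quantum states

A vector of the Hilbert space with orthonormal basis `ι` is a function `ι → ℂ`; an operator is a
complex matrix indexed by `ι`. Registers are combined by products of index types. Functions of a
Hermitian matrix are taken by the functional calculus `cfc`. -/

section Basic

variable {ι : Type*} [Fintype ι]

/-- `v` is a normalized vector. -/
def IsNormalized (v : ι → ℂ) : Prop := ∑ i, ‖v i‖ ^ 2 = 1

/-- The normalized vector proportional to `v` (for `v ≠ 0`). -/
def normalize (v : ι → ℂ) : ι → ℂ := fun i => ((√(∑ j, ‖v j‖ ^ 2))⁻¹ : ℝ) * v i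

/-- The rank-one operator `|v⟩⟨v|`. -/
def proj (v : ι → ℂ) : Matrix ι ι ℂ := Matrix.vecMulVec v (star v)

variable [DecidableEq ι]

/-- Trace norm `Tr √(A† A)`. -/
def traceNorm (A : Matrix ι ι ℂ) : ℝ := (cfc Real.sqrt (Aᴴ * A)).trace.re

/-- Von Neumann entropy `-Tr ρ log₂ ρ`, in bits. -/
def entropy (ρ : Matrix ι ι ℂ) : ℝ := (cfc Real.negMulLog ρ).trace.re / Real.log 2

/-- Holevo quantity of the ensemble `{1/2, ρ^x}` of two equally likely states. -/
def holevo (ρ : ZMod 2 → Matrix ι ι ℂ) : ℝ :=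
  entropy ((1 / 2 : ℂ) • ∑ x, ρ x) - 1 / 2 * ∑ x, entropy (ρ x)

/-- Projection onto the typical subspace of a state `σ` of `n` systems with entropy `s` per system:
the span of the eigenvectors of `σ` with eigenvalue between `2^(-n(s+δ))` and `2^(-n(s-δ))`. -/
def typicalProj (n : ℕ) (s δ : ℝ) (σ : Matrix ι ι ℂ) : Matrix ι ι ℂ :=
  open Classical in
  cfc (fun t : ℝ =>
    if (2 : ℝ) ^ (-(n * (s + δ))) ≤ t ∧ t ≤ (2 : ℝ) ^ (-(n * (s - δ))) then 1 else 0) σ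

/-- The square root of the pseudo-inverse of a positive semidefinite matrix
(`0⁻¹ = 0`, so that the kernel is mapped to zero). -/
def invSqrt (T : Matrix ι ι ℂ) : Matrix ι ι ℂ := cfc (fun t : ℝ => (√t)⁻¹) T

/-- Pretty good measurement of a finite family `Λ` of positive operators:
`E^y = T^{-1/2} Λ^y T^{-1/2}` with `T = ∑ Λ^y`. -/
def prettyGood {Y : Type*} [Fintype Y] (Λ : Y → Matrix ι ι ℂ) (y : Y) : Matrix ι ι ℂ :=
  invSqrt (∑ y', Λ y') * Λ y * invSqrt (∑ y', Λ y')

end Basic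

/-- For a vector `Ψ` on registers `A`, `B`, `S`, `E` and a vector `f` on `A`, the (unnormalized)
operator `⟨f|_A Ψ_{ABS} |f⟩_A` on `BS`, where `Ψ_{ABS} = Tr_E |Ψ⟩⟨Ψ|`. -/
def condState {A B S E : Type*} [Fintype A] [Fintype E] (f : A → ℂ) (Ψ : A × B × S × E → ℂ) :
    Matrix (B × S) (B × S) ℂ :=
  Matrix.of fun p q => ∑ a, ∑ a', ∑ e,
    star (f a) * (Ψ (a, p.1, p.2, e) * star (Ψ (a', q.1, q.2, e))) * f a'

/-! ### Conjugate bases -/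

/-- Amplitude of `|a⟩` in the `x`-basis state `|x̃⟩ = (|0⟩ + (-1)^x |1⟩)/√2` of a qubit. -/
def xKetBit (x a : ZMod 2) : ℂ := (-1) ^ (x * a).val / (√2 : ℝ)

/-- The `x`-basis state `|x̃⟩` of `n` qubits, for a string `x`. -/
def xKet {n : ℕ} (x : Bits n) : Bits n → ℂ := fun a => ∏ i, xKetBit (x i) (a i)

/-- Eigenvalue `(-1)^(x·b)` of `Z^x` on `|b⟩`. -/
def zPhase {n : ℕ} (x b : Bits n) : ℂ := ∏ i, (-1) ^ (x i * b i).val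

/-! ### The input -/

section Input

variable {S E : Type*} [Fintype S] [DecidableEq S] [Fintype E] [DecidableEq E]

/-- `|ψ⟩_{ABSE} = (1/√2) ∑_k |kk⟩_{AB} |φ^k⟩_{SE}`. -/
def inputState (φ : ZMod 2 → S × E → ℂ) : ZMod 2 × ZMod 2 × S × E → ℂ := fun p =>
  if p.1 = p.2.1 then φ p.1 p.2.2 / (√2 : ℝ) else 0

/-- `|Ψ⟩_{ABSE} = |ψ⟩^{⊗n}`. -/
def inputPow (φ : ZMod 2 → S × E → ℂ) (n : ℕ) :
    Bits n × Bits n × (Fin n → S) × (Fin n → E) → ℂ := fun p =>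
  ∏ i, inputState φ (p.1 i, p.2.1 i, p.2.2.1 i, p.2.2.2 i)

/-- `ρ^x_{BS} = 2 ⟨x̃|_A ψ_{ABS} |x̃⟩_A`: the state of `BS` given the outcome `x` of a measurement
of `A` in the `x`-basis. -/
def ensemble (φ : ZMod 2 → S × E → ℂ) (x : ZMod 2) : Matrix (ZMod 2 × S) (ZMod 2 × S) ℂ :=
  (2 : ℂ) • condState (xKetBit x) (inputState φ)

/-- The average state `ρ_{BS}` of the ensemble. -/
def avgState (φ : ZMod 2 → S × E → ℂ) : Matrix (ZMod 2 × S) (ZMod 2 × S) ℂ :=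
  (1 / 2 : ℂ) • ∑ x, ensemble φ x

/-! ### The protocol

A linear bijection `c : F₂^n ≃ F₂^r × F₂^m` decomposes the `n` qubits of Alice (and likewise those of
Bob) into encoded qubits: `|k⟩ = |ℓ⟩_{A₁} |m⟩_{A₂}` for `c k = (ℓ, m)`. A shift of the `i`-th bit of
`A₂` shifts `k` by `u_i = c⁻¹(0, e_i)`, so that the Pauli operator `X` of the `i`-th qubit of `A₂` is
`X^{u_i}`, and measuring `A₂` in the `x`-basis gives `h_i = u_i · x`, where `x` is the outcome of
an `x`-basis measurement of all of Alice's qubits. The key bits are `ℓ_j = v_j · k` for vectors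
`v_j` with `u_i · v_j = 0`. -/

variable {n r m : ℕ}

/-- The normalized state of `A₁`, `B₁`, the shield `B₂S`, and `E` after Alice measures the
`X^{u_i}`, announces the outcome `h`, and Bob applies `Z^h` to `B₂`:
`⟨h̃|_{A₂} Z^h_{B₂} |Ψ⟩`. -/
def announced (φ : ZMod 2 → S × E → ℂ) (c : Bits n ≃ₗ[ZMod 2] Bits r × Bits m) (h : Bits m) :
    Bits r × Bits r × (Bits m × (Fin n → S)) × (Fin n → E) → ℂ :=
  normalize fun p =>
    ∑ a₂, star (xKet h a₂) * (zPhase h p.2.2.1.1 *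
      inputPow φ n (c.symm (p.1, a₂), c.symm (p.2.1, p.2.2.1.1), p.2.2.1.2, p.2.2.2))

/-- `ϱ^y_{BS}`: the state of `BS` after the announcement, given that `A₁` is found in `|ỹ⟩`. -/
def codeState (φ : ZMod 2 → S × E → ℂ) (c : Bits n ≃ₗ[ZMod 2] Bits r × Bits m) (h : Bits m)
    (y : Bits r) : Matrix (Bits r × Bits m × (Fin n → S)) (Bits r × Bits m × (Fin n → S)) ℂ :=
  (2 ^ r : ℂ) • condState (xKet y) (announced φ c h)

/-- `ρ_{BS}^{⊗n}`, written in the registers `B₁`, `B₂`, `S`. -/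
def avgPow (φ : ZMod 2 → S × E → ℂ) (c : Bits n ≃ₗ[ZMod 2] Bits r × Bits m) :
    Matrix (Bits r × Bits m × (Fin n → S)) (Bits r × Bits m × (Fin n → S)) ℂ :=
  Matrix.of fun p q => ∏ i, avgState φ (c.symm (p.1, p.2.1) i, p.2.2 i)
    (c.symm (q.1, q.2.1) i, q.2.2 i)

/-- Bob's measurement of `y`: the pretty good measurement of the operators `Π Π^y Π`, where `Π^y`
and `Π` are the typical projections of `ϱ^y` and of the average state. -/
def bobPGM (φ : ZMod 2 → S × E → ℂ) (c : Bits n ≃ₗ[ZMod 2] Bits r × Bits m) (h : Bits m) (δ : ℝ) :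
    Bits r → Matrix (Bits r × Bits m × (Fin n → S)) (Bits r × Bits m × (Fin n → S)) ℂ :=
  prettyGood fun y =>
    typicalProj n (entropy (avgState φ)) δ (avgPow φ c) *
      typicalProj n (1 / 2 * ∑ x, entropy (ensemble φ x)) δ (codeState φ c h y) *
      typicalProj n (entropy (avgState φ)) δ (avgPow φ c)

end Input

/-! ### Private states and secret keys -/

section Private

variable {r : ℕ} {S E : Type*} [Fintype S] [DecidableEq S] [Fintype E] [DecidableEq E]

/-- The twisting operator `U = ∑_ℓ P^ℓ ⊗ V^ℓ` on a key register of `r` qubits and a shield. -/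
def twist (V : Bits r → Matrix S S ℂ) : Matrix (Bits r × S) (Bits r × S) ℂ :=
  Matrix.of fun p q => if p.1 = q.1 then V p.1 p.2 q.2 else 0

/-- `2^(-r/2) ∑_k |kk⟩_{AB} V^k_S |ξ⟩_{SE} = U_{BS} |Φ⟩^{⊗r}_{AB} |ξ⟩_{SE}`, `U = twist V`. For
unitary `V^k` and normalized `ξ` this is the private state of `r` bits. -/
def privateState (V : Bits r → Matrix S S ℂ) (ξ : S × E → ℂ) : Bits r × Bits r × S × E → ℂ :=
  fun p => if p.1 = p.2.1 then
    ((√2 : ℝ)⁻¹ : ℂ) ^ r * ∑ s, V p.1 p.2.2.1 s * ξ (s, p.2.2.2) else 0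

/-- The pure state `Ψ` is `ε`-close, in trace distance, to the private state of `V` and `ξ`. -/
def IsClosePrivate (ε : ℝ) (V : Bits r → Matrix S S ℂ) (ξ : S × E → ℂ)
    (Ψ : Bits r × Bits r × S × E → ℂ) : Prop :=
  traceNorm (proj Ψ - proj (privateState V ξ)) ≤ 2 * ε

/-- The state of `A`, `B`, `E` after standard basis measurements of the key registers `A` and `B`,
the shield being traced out. -/
def measuredKey (Ψ : Bits r × Bits r × S × E → ℂ) :
    Matrix (Bits r × Bits r × E) (Bits r × Bits r × E) ℂ :=
  Matrix.of fun p q => if p.1 = q.1 ∧ p.2.1 = q.2.1 then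
    ∑ s, Ψ (p.1, p.2.1, s, p.2.2) * star (Ψ (q.1, q.2.1, s, q.2.2)) else 0

/-- The perfect secret key of `r` bits, `(2^(-r) ∑_k P^k_A ⊗ P^k_B) ⊗ ρ_E`. -/
def secretKey (r : ℕ) (ρE : Matrix E E ℂ) :
    Matrix (Bits r × Bits r × E) (Bits r × Bits r × E) ℂ :=
  Matrix.of fun p q => if p.1 = q.1 ∧ p.2.1 = q.2.1 ∧ p.1 = p.2.1 then
    (1 / 2 : ℂ) ^ r * ρE p.2.2 q.2.2 else 0

/-- The vector `Ψ` yields, on measurement, an `ε`-private key of `r` bits. -/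
def IsEpsPrivate (ε : ℝ) (Ψ : Bits r × Bits r × S × E → ℂ) : Prop :=
  ∃ ρE : Matrix E E ℂ, ρE.PosSemidef ∧ ρE.trace = 1 ∧
    traceNorm (measuredKey Ψ - secretKey r ρE) ≤ 2 * ε

/-- The twisting operator of `V` turns the measurement `F` of the shielded key register into an
`x`-basis measurement of the key: `F^y = Q U (P^ỹ ⊗ 1) U† Q`, where `Q = ∑ F^y` is the projection
onto the support of the measurement (`Q = 1` if the measurement is complete). -/
def Untwists (V : Bits r → Matrix S S ℂ) (F : Bits r → Matrix (Bits r × S) (Bits r × S) ℂ) : Prop :=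
  (∀ ℓ, V ℓ ∈ Matrix.unitaryGroup S ℂ) ∧
  ∀ y, F y = (∑ y', F y') * twist V * (proj (xKet y) ⊗ₖ (1 : Matrix S S ℂ)) * (twist V)ᴴ *
    (∑ y', F y')

end Private

/-- The hash `x ↦ (u_i · x)_i` is `ε`-good for `n` copies of the input: for every choice of encoded
qubits in which the measured observables are the `X^{u_i}`, and for every announcement `h`,
* Bob's pretty good measurement finds `y` with error probability at most `ε`,
* there is an untwisting operator for this measurement such that the state is `ε`-close, in trace
  distance, to a private state of `r` bits with this twisting operator, and
* the key obtained by measuring is `ε`-private. -/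
def GoodHash {S E : Type*} [Fintype S] [DecidableEq S] [Fintype E] [DecidableEq E]
    (φ : ZMod 2 → S × E → ℂ) {n m : ℕ} (r : ℕ) (δ ε : ℝ) (u : Fin m → Bits n) : Prop :=
  ∀ c : Bits n ≃ₗ[ZMod 2] Bits r × Bits m, (∀ i, c.symm (0, Pi.single i 1) = u i) →
    ∀ h : Bits m,
      1 - ε ≤ (1 / 2 : ℝ) ^ r * ∑ y, (codeState φ c h y * bobPGM φ c h δ y).trace.re ∧
      (∃ (V : Bits r → Matrix (Bits m × (Fin n → S)) (Bits m × (Fin n → S)) ℂ)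
        (ξ : (Bits m × (Fin n → S)) × (Fin n → E) → ℂ),
          Untwists V (bobPGM φ c h δ) ∧ IsNormalized ξ ∧
          IsClosePrivate ε V ξ (announced φ c h)) ∧
      IsEpsPrivate ε (announced φ c h)

end PrivateState

end

/-!
Bob's states `ϱ^y` are conjugates of `ϱ^0` by the phases `Z^y`, which commute with the typical
projection of their average. So his pretty good measurement is covariant, and it suffices to bound
its error on `ϱ^0`: by the Hayashi–Nagaoka inequality, by the weight of atypical eigenvectors and
the overlaps of `ϱ^0` with the typical subspaces of the other codewords. A nonzero string satisfies
`m` random independent parity checks with probability at most `2^{-m}`, so below the rate `χ` the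
expected sum of the overlaps tends to zero, and by Markov's inequality most families are good.

At such a rate each `E^y` has rank at most the dimension of the shield, so `E^0 = X† X` for an `X`
with values in the shield. Comparing the blocks of `X` with those of the projection `∑_y E^y`, which
is block diagonal by covariance, yields the unitaries `V^ℓ`. If the error is small, `⟨0̃| U†` maps
the amplitudes of the state almost isometrically to those of `ξ`; this gives the private state,
whose measured key is perfect.
-/

noncomputable section

namespace PrivateState

open scoped MatrixOrder

/-! ### Functional calculus of matrices -/

section FunctionalCalculus

variable {ι κ : Type*} [Fintype ι] [DecidableEq ι] [Fintype κ] [DecidableEq κ]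

theorem continuousOn_spectrum (f : ℝ → ℝ) (A : Matrix ι ι ℂ) : ContinuousOn f (spectrum ℝ A) :=
  Matrix.finite_real_spectrum.continuousOn f

theorem isHermitian_cfc (f : ℝ → ℝ) (A : Matrix ι ι ℂ) : (cfc f A).IsHermitian :=
  cfc_predicate f A

theorem map_cfc_matrix (Φ : Matrix ι ι ℂ →⋆ₐ[ℝ] Matrix κ κ ℂ) (f : ℝ → ℝ) {A : Matrix ι ι ℂ}
    (hA : A.IsHermitian) : Φ (cfc f A) = cfc f (Φ A) :=
  Φ.map_cfc f A (continuousOn_spectrum f A) Φ.toAlgHom.toLinearMap.continuous_of_finiteDimensional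
    hA (IsSelfAdjoint.map hA Φ)

theorem cfc_submatrix (f : ℝ → ℝ) (e : κ ≃ ι) {A : Matrix ι ι ℂ} (hA : A.IsHermitian) :
    cfc f (A.submatrix e e) = (cfc f A).submatrix e e :=
  (map_cfc_matrix
    { (Matrix.reindexAlgEquiv ℝ ℂ e.symm : Matrix ι ι ℂ →ₐ[ℝ] Matrix κ κ ℂ) with
      map_star' := fun _ => rfl } f hA).symm

theorem cfc_unitary_conj (f : ℝ → ℝ) (W : Matrix.unitaryGroup ι ℂ) {A : Matrix ι ι ℂ}
    (hA : A.IsHermitian) :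
    cfc f ((W : Matrix ι ι ℂ) * A * (W : Matrix ι ι ℂ)ᴴ) =
      (W : Matrix ι ι ℂ) * cfc f A * (W : Matrix ι ι ℂ)ᴴ :=
  (map_cfc_matrix
    (Unitary.conjStarAlgAut ℝ (Matrix ι ι ℂ) W : Matrix ι ι ℂ →⋆ₐ[ℝ] Matrix ι ι ℂ) f hA).symm

/-- The homomorphism `d ↦ W diag(d) W†`, whose values are the Hermitian matrices with eigenbasis
the columns of `W`. -/
def spectralHom (W : Matrix.unitaryGroup ι ℂ) : (ι → ℝ) →⋆ₐ[ℝ] Matrix ι ι ℂ :=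
  (Unitary.conjStarAlgAut ℝ (Matrix ι ι ℂ) W : Matrix ι ι ℂ →⋆ₐ[ℝ] Matrix ι ι ℂ).comp
    { (Matrix.diagonalAlgHom ℝ).comp (Complex.ofRealAm.compLeft ι) with
      map_star' := fun d => by
        ext i j
        by_cases h : i = j <;> simp [h, Matrix.star_apply, eq_comm] }

theorem spectralHom_apply (W : Matrix.unitaryGroup ι ℂ) (d : ι → ℝ) :
    spectralHom W d =
      (W : Matrix ι ι ℂ) * Matrix.diagonal (fun i => (d i : ℂ)) * (W : Matrix ι ι ℂ)ᴴ := rfl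

theorem isHermitian_spectralHom (W : Matrix.unitaryGroup ι ℂ) (d : ι → ℝ) :
    (spectralHom W d).IsHermitian :=
  IsSelfAdjoint.map (IsSelfAdjoint.all d) (spectralHom W)

theorem exists_eq_spectralHom {A : Matrix ι ι ℂ} (hA : A.IsHermitian) :
    ∃ W d, A = spectralHom W d :=
  ⟨hA.eigenvectorUnitary, hA.eigenvalues, hA.spectral_theorem⟩

theorem spectralHom_mono (W : Matrix.unitaryGroup ι ℂ) : Monotone (spectralHom W) :=
  OrderHomClass.mono (spectralHom W)

theorem exists_eq_spectralHom_nonneg {A : Matrix ι ι ℂ} (hA : 0 ≤ A) :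
    ∃ W, ∃ d : ι → ℝ, 0 ≤ d ∧ A = spectralHom W d :=
  have hA' := Matrix.nonneg_iff_posSemidef.1 hA
  ⟨hA'.1.eigenvectorUnitary, hA'.1.eigenvalues, hA'.eigenvalues_nonneg, hA'.1.spectral_theorem⟩

theorem trace_spectralHom (W : Matrix.unitaryGroup ι ℂ) (d : ι → ℝ) :
    (spectralHom W d).trace = ((∑ i, d i : ℝ) : ℂ) := by
  rw [spectralHom_apply, Matrix.trace_mul_cycle, ← Matrix.star_eq_conjTranspose,
    Matrix.UnitaryGroup.star_mul_self, Matrix.one_mul, Matrix.trace_diagonal, Complex.ofReal_sum]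

theorem cfc_spectralHom (f : ℝ → ℝ) (W : Matrix.unitaryGroup ι ℂ) (d : ι → ℝ) :
    cfc f (spectralHom W d) = spectralHom W (f ∘ d) := by
  classical
  set G : Finset ℝ :=
    (Matrix.finite_real_spectrum (A := spectralHom W d)).toFinset ∪ Finset.univ.image d
  set p : Polynomial ℝ := Lagrange.interpolate G id f
  have hp : ∀ t ∈ G, f t = p.eval t := fun t ht =>
    (Lagrange.eval_interpolate_at_node (v := id) f (Set.injOn_id _) ht).symm
  calc cfc f (spectralHom W d) = cfc p.eval (spectralHom W d) :=
        cfc_congr fun t ht => hp t (by simp [G, ht])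
    _ = spectralHom W (Polynomial.aeval d p) :=
        (cfc_polynomial p _ (isHermitian_spectralHom W d)).trans
          (Polynomial.aeval_algHom_apply (spectralHom W) d p)
    _ = spectralHom W (f ∘ d) := by
        congr 1
        ext i
        rw [Polynomial.aeval_pi_apply₂, Polynomial.coe_aeval_eq_eval, Function.comp_apply,
          hp (d i) (by simp [G])]

theorem isStarProjection_cfc {f : ℝ → ℝ} (hf : ∀ t, f t * f t = f t) (A : Matrix ι ι ℂ) :
    IsStarProjection (cfc f A) where
  isIdempotentElem := by
    rw [IsIdempotentElem, ← cfc_mul f f A (continuousOn_spectrum f A) (continuousOn_spectrum f A)]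
    exact cfc_congr fun t _ => hf t
  isSelfAdjoint := cfc_predicate f A

end FunctionalCalculus

/-! ### Positive operators -/

section Projections

variable {R : Type*} [Ring R] [StarRing R] [PartialOrder R] [StarOrderedRing R]

theorem one_sub_conj_le {P N : R} (hP : IsStarProjection P) (hN : IsStarProjection N) :
    1 - P * N * P ≤ 3 • (1 - P) + 2 • (1 - N) := by
  have hM := hP.one_sub.isSelfAdjoint
  have hPP : P * P = P := hP.isIdempotentElem
  have e : 3 • (1 - P) + 2 • (1 - N) - (1 - P * N * P) =
      2 • ((1 - P) * N * (1 - P)) + (1 + (1 - P)) * (1 - N) * (1 + (1 - P)) := by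
    simp only [succ_nsmul, zero_nsmul, mul_add, add_mul, mul_sub, sub_mul, mul_one, one_mul, hPP]
    abel
  rw [← sub_nonneg, e]
  exact add_nonneg (nsmul_nonneg (hM.conjugate_nonneg hN.nonneg) 2)
    (((IsSelfAdjoint.one R).add hM).conjugate_nonneg hN.one_sub.nonneg)

theorem one_sub_le_two_nsmul_one_sub_conj {Q G : R} (hQ : IsStarProjection Q)
    (hG : IsStarProjection G) : 1 - G ≤ 2 • (1 - Q * G * Q) := by
  have hM := hQ.one_sub.isSelfAdjoint
  have hQQ : Q * Q = Q := hQ.isIdempotentElem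
  have e : 2 • (1 - Q * G * Q) - (1 - G) =
      (Q - (1 - Q)) * (1 - G) * (Q - (1 - Q)) + 2 • ((1 - Q) * G * (1 - Q)) := by
    simp only [two_nsmul, mul_sub, sub_mul, mul_one, one_mul, hQQ]
    abel
  rw [← sub_nonneg, e]
  exact add_nonneg ((hQ.isSelfAdjoint.sub hM).conjugate_nonneg hG.one_sub.nonneg)
    (nsmul_nonneg (hM.conjugate_nonneg hG.nonneg) 2)

end Projections

section Trace

variable {ι : Type*} [Fintype ι]

theorem trace_mul_nonneg {A B : Matrix ι ι ℂ} (hA : 0 ≤ A) (hB : 0 ≤ B) :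
    0 ≤ (A * B).trace := by
  classical
  obtain ⟨C, rfl⟩ := CStarAlgebra.nonneg_iff_eq_star_mul_self.1 hA
  rw [Matrix.mul_assoc, Matrix.trace_mul_comm]
  exact (Matrix.nonneg_iff_posSemidef.1 (star_right_conjugate_nonneg hB C)).trace_nonneg

theorem trace_mul_re_mono {σ A B : Matrix ι ι ℂ} (hσ : 0 ≤ σ) (h : A ≤ B) :
    (σ * A).trace.re ≤ (σ * B).trace.re := by
  have := trace_mul_nonneg hσ (sub_nonneg.2 h)
  rw [Matrix.mul_sub, Matrix.trace_sub, sub_nonneg] at this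
  exact (Complex.le_def.1 this).1

variable [DecidableEq ι]

theorem traceNorm_spectralHom (W : Matrix.unitaryGroup ι ℂ) (d : ι → ℝ) :
    traceNorm (spectralHom W d) = ∑ i, |d i| := by
  rw [traceNorm, (isHermitian_spectralHom W d).eq, ← map_mul, cfc_spectralHom,
    trace_spectralHom, Complex.ofReal_re]
  exact Finset.sum_congr rfl fun i _ => Real.sqrt_mul_self_eq_abs (d i)

theorem exists_traceNorm_eq_trace_mul {A : Matrix ι ι ℂ} (hA : A.IsHermitian) :
    ∃ F, F ≤ 1 ∧ -F ≤ 1 ∧ traceNorm A = (A * F).trace.re := by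
  obtain ⟨W, d, rfl⟩ := exists_eq_spectralHom hA
  have hs : ∀ t : ℝ, Real.sign t ≤ 1 ∧ -Real.sign t ≤ 1 ∧ |t| = t * Real.sign t := fun t => by
    rcases lt_trichotomy t 0 with h | rfl | h
    · simp [Real.sign_of_neg h, abs_of_neg h]
    · simp
    · simp [Real.sign_of_pos h, abs_of_pos h]
  refine ⟨spectralHom W (Real.sign ∘ d), ?_, ?_, ?_⟩
  · rw [← map_one (spectralHom W)]
    exact spectralHom_mono W fun i => (hs (d i)).1
  · rw [← map_one (spectralHom W), ← map_neg]
    exact spectralHom_mono W fun i => (hs (d i)).2.1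
  · rw [traceNorm_spectralHom, ← map_mul, trace_spectralHom, Complex.ofReal_re]
    exact Finset.sum_congr rfl fun i _ => (hs (d i)).2.2

theorem traceNorm_sub_le {X Y : Matrix ι ι ℂ} (hX : 0 ≤ X) (hY : 0 ≤ Y) :
    traceNorm (X - Y) ≤ X.trace.re + Y.trace.re := by
  obtain ⟨F, hF, hF', h⟩ := exists_traceNorm_eq_trace_mul
    ((IsSelfAdjoint.of_nonneg hX).sub (IsSelfAdjoint.of_nonneg hY))
  have hX' := trace_mul_re_mono hX hF
  have hY' := trace_mul_re_mono hY hF'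
  rw [Matrix.mul_one] at hX' hY'
  rw [Matrix.mul_neg, Matrix.trace_neg, Complex.neg_re] at hY'
  rw [h, Matrix.sub_mul, Matrix.trace_sub, Complex.sub_re]
  linarith

end Trace

section PrettyGood

variable {ι : Type*} [Fintype ι] [DecidableEq ι]

theorem isHermitian_invSqrt (T : Matrix ι ι ℂ) : (invSqrt T).IsHermitian :=
  isHermitian_cfc _ T

theorem invSqrt_mul_self {T : Matrix ι ι ℂ} (hT : 0 ≤ T) : invSqrt T * T = CFC.sqrt T := by
  obtain ⟨W, d, -, rfl⟩ := exists_eq_spectralHom_nonneg hT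
  rw [invSqrt, CFC.sqrt_eq_real_sqrt _ hT, cfcₙ_eq_cfc, cfc_spectralHom, cfc_spectralHom, ← map_mul]
  congr 1
  ext i
  change (√(d i))⁻¹ * d i = √(d i)
  rw [inv_mul_eq_div, Real.div_sqrt]

theorem self_mul_invSqrt {T : Matrix ι ι ℂ} (hT : 0 ≤ T) : T * invSqrt T = CFC.sqrt T := by
  rw [← invSqrt_mul_self hT]
  exact ((Commute.refl T).cfc_real _).symm

theorem isStarProjection_invSqrt_conj {T : Matrix ι ι ℂ} (hT : 0 ≤ T) :
    IsStarProjection (invSqrt T * T * invSqrt T) := by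
  obtain ⟨W, d, hd, rfl⟩ := exists_eq_spectralHom_nonneg hT
  rw [invSqrt, cfc_spectralHom, ← map_mul, ← map_mul]
  refine IsStarProjection.map ?_ (spectralHom W)
  refine ⟨?_, IsSelfAdjoint.all _⟩
  ext i
  simp only [Pi.mul_apply, Function.comp_apply]
  rcases (hd i).eq_or_lt with h | h
  · simp [← h]
  · have h' : √(d i) ≠ 0 := (Real.sqrt_pos.2 h).ne'
    field_simp
    rw [Real.sq_sqrt h.le, sq]

open scoped Matrix.Norms.L2Operator in
theorem le_sqrt_add {A T : Matrix ι ι ℂ} (hA : 0 ≤ A) (hA1 : A ≤ 1) (hT : 0 ≤ T) :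
    A ≤ CFC.sqrt (A + T) := by
  have hAs : IsSelfAdjoint A := .of_nonneg hA
  have e : A + T - A * A = (1 - A) * A * (1 - A) + A * (1 - A) * A + T := by noncomm_ring
  have hle : A * A ≤ A + T := by
    rw [← sub_nonneg, e]
    exact add_nonneg (add_nonneg (((IsSelfAdjoint.one _).sub hAs).conjugate_nonneg hA)
      (hAs.conjugate_nonneg (sub_nonneg.2 hA1))) hT
  calc A = CFC.sqrt (A * A) := (CFC.sqrt_mul_self A hA).symm
    _ ≤ CFC.sqrt (A + T) := CFC.sqrt_le_sqrt _ _ hle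

/-- The Hayashi–Nagaoka inequality. -/
theorem one_sub_invSqrt_conj_le {A T : Matrix ι ι ℂ} (hA : 0 ≤ A) (hA1 : A ≤ 1) (hT : 0 ≤ T) :
    1 - invSqrt (A + T) * A * invSqrt (A + T) ≤ 2 • (1 - A) + 4 • T := by
  have hAT := add_nonneg hA hT
  have hP := isStarProjection_invSqrt_conj hAT
  have hR : IsSelfAdjoint (invSqrt (A + T)) := isHermitian_invSqrt _
  have hRK := invSqrt_mul_self hAT
  have hKR := self_mul_invSqrt hAT
  have hAK := le_sqrt_add hA hA1 hT
  set R := invSqrt (A + T)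
  set K := CFC.sqrt (A + T)
  rw [hRK] at hP
  have e : 2 • (1 - A) + 4 • T - (1 - R * A * R) =
      (R - (1 + 1)) * T * (R - (1 + 1)) + 2 • ((R - 1) * A * (R - 1)) + (1 - K * R) +
        4 • (K - A) := by
    have hRA : R * A = K - R * T := by rw [← hRK, mul_add]; abel
    have hAR : A * R = K - T * R := by rw [← hKR, add_mul]; abel
    simp only [succ_nsmul, zero_nsmul, mul_add, add_mul, mul_sub, sub_mul, mul_one, one_mul,
      hRA, hAR]
    abel
  have h1 := IsSelfAdjoint.one (Matrix ι ι ℂ)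
  rw [← sub_nonneg, e]
  exact add_nonneg (add_nonneg (add_nonneg
    ((hR.sub (h1.add h1)).conjugate_nonneg hT)
    (nsmul_nonneg ((hR.sub h1).conjugate_nonneg hA) 2)) hP.one_sub.nonneg)
    (nsmul_nonneg (sub_nonneg.2 hAK) 4)

end PrettyGood

section Factorization

theorem exists_conjTranspose_mul_self_of_rank_le {ι κ : Type*} [Fintype ι] [Fintype κ]
    {A : Matrix ι ι ℂ} (hA : 0 ≤ A) (h : A.rank ≤ Fintype.card κ) :
    ∃ X : Matrix κ ι ℂ, Xᴴ * X = A := by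
  classical
  have hA' := Matrix.nonneg_iff_posSemidef.1 hA
  rw [hA'.1.rank_eq_card_non_zero_eigs] at h
  obtain ⟨f⟩ := Function.Embedding.nonempty_of_card_le h
  set d := hA'.1.eigenvalues
  set W : Matrix ι ι ℂ := (hA'.1.eigenvectorUnitary : Matrix ι ι ℂ)
  set G : Matrix κ {i // d i ≠ 0} ℂ := (1 : Matrix κ κ ℂ).submatrix id f
  set D : Matrix {i // d i ≠ 0} ι ℂ :=
    (Matrix.diagonal fun i => ((√(d i) : ℝ) : ℂ)).submatrix (↑) id
  have hG : Gᴴ * G = 1 := by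
    ext i j
    simp [G, Matrix.mul_apply, Matrix.one_apply]
  have hD : Dᴴ * D = Matrix.diagonal fun i => (d i : ℂ) := by
    have hsq : (fun i => (d i : ℂ)) = fun i => ((√(d i) : ℝ) : ℂ) * ((√(d i) : ℝ) : ℂ) :=
      funext fun i => by
        rw [← Complex.ofReal_mul, Real.mul_self_sqrt (hA'.eigenvalues_nonneg i)]
    ext i j
    rw [hsq, ← Matrix.diagonal_mul_diagonal, Matrix.mul_apply, Matrix.mul_apply]
    refine Fintype.sum_of_injective _ Subtype.val_injective _ _ (fun k hk => ?_) fun k => ?_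
    · have hk' : d k = 0 := by simpa using hk
      simp [Matrix.diagonal_apply, hk']
    · by_cases hi : i = k <;> simp [D, hi, Matrix.diagonal_apply, eq_comm]
  refine ⟨G * D * Wᴴ, ?_⟩
  calc (G * D * Wᴴ)ᴴ * (G * D * Wᴴ) = W * (Dᴴ * (Gᴴ * G) * D) * Wᴴ := by
        simp only [Matrix.conjTranspose_mul, Matrix.conjTranspose_conjTranspose, Matrix.mul_assoc]
    _ = A := by
        rw [hG, Matrix.mul_one, hD]
        exact hA'.1.spectral_theorem.symm

theorem exists_linearIsometry_comp_eq {𝕜 U V : Type*} [RCLike 𝕜] [AddCommGroup U] [Module 𝕜 U]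
    [NormedAddCommGroup V] [InnerProductSpace 𝕜 V] [FiniteDimensional 𝕜 V] {x y : U →ₗ[𝕜] V}
    (h : ∀ u, ‖x u‖ = ‖y u‖) : ∃ O : V →ₗᵢ[𝕜] V, ∀ u, O (y u) = x u := by
  obtain ⟨s, hs⟩ := y.rangeRestrict.exists_rightInverse_of_surjective y.range_rangeRestrict
  have hys : ∀ v, y (s v) = v := fun v => congrArg Subtype.val (LinearMap.congr_fun hs v)
  let g : LinearMap.range y →ₗᵢ[𝕜] V :=
    { toLinearMap := x ∘ₗ s
      norm_map' := fun v => by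
        rw [LinearMap.comp_apply, h, hys, Submodule.coe_norm] }
  refine ⟨g.extend, fun u => ?_⟩
  have hxs : x (s (y.rangeRestrict u)) = x u := by
    rw [← sub_eq_zero, ← map_sub, ← norm_eq_zero, h, map_sub, hys, LinearMap.codRestrict_apply,
      sub_self, norm_zero]
  exact (g.extend_apply (y.rangeRestrict u)).trans hxs

theorem exists_unitary_mul_eq {κ : Type*} [Fintype κ] [DecidableEq κ] {X Y : Matrix κ κ ℂ}
    (h : Xᴴ * X = Yᴴ * Y) : ∃ O ∈ Matrix.unitaryGroup κ ℂ, O * Y = X := by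
  have hinner : ∀ (M : Matrix κ κ ℂ) v w, inner ℂ (Matrix.toEuclideanLin M v)
      (Matrix.toEuclideanLin M w) = inner ℂ v (Matrix.toEuclideanLin (Mᴴ * M) w) := by
    intro M v w
    rw [Matrix.toEuclideanLin, Matrix.toLpLin_mul_same, LinearMap.comp_apply,
      ← Matrix.toEuclideanLin, Matrix.toEuclideanLin_conjTranspose_eq_adjoint,
      LinearMap.adjoint_inner_right]
  obtain ⟨L, hL⟩ := exists_linearIsometry_comp_eq (x := Matrix.toEuclideanLin X)
    (y := Matrix.toEuclideanLin Y) fun u => by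
      rw [norm_eq_sqrt_re_inner (𝕜 := ℂ), norm_eq_sqrt_re_inner (𝕜 := ℂ), hinner, hinner, h]
  refine ⟨Matrix.toEuclideanLin.symm L.toLinearMap, ?_, ?_⟩
  · rw [Matrix.mem_unitaryGroup_iff']
    apply Matrix.toEuclideanLin.injective
    ext1 w
    refine ext_inner_left ℂ fun v => ?_
    rw [Matrix.star_eq_conjTranspose, ← hinner, LinearEquiv.apply_symm_apply]
    simp [Matrix.toEuclideanLin]
  · apply Matrix.toEuclideanLin.injective
    ext1 v
    rw [← hL v, Matrix.toEuclideanLin, Matrix.toLpLin_mul_same, LinearMap.comp_apply,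
      ← Matrix.toEuclideanLin, LinearEquiv.apply_symm_apply]
    rfl

end Factorization

/-! ### Phases -/

section Phase

variable {n : ℕ}

theorem neg_one_pow_val_add (a b : ZMod 2) :
    (-1 : ℂ) ^ (a + b).val = (-1) ^ a.val * (-1) ^ b.val := by
  rw [← pow_add, neg_one_pow_eq_pow_mod_two, ZMod.val_add, Nat.mod_mod,
    ← neg_one_pow_eq_pow_mod_two]

theorem zPhase_eq (x b : Bits n) : zPhase x b = (-1) ^ (x ⬝ᵥ b).val := by
  rw [zPhase, dotProduct]
  induction (Finset.univ : Finset (Fin n)) using Finset.induction_on with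
  | empty => simp
  | insert i s hi ih => rw [Finset.prod_insert hi, Finset.sum_insert hi, neg_one_pow_val_add, ih]

theorem zPhase_add_right (x b b' : Bits n) : zPhase x (b + b') = zPhase x b * zPhase x b' := by
  simp only [zPhase_eq, dotProduct_add, neg_one_pow_val_add]

theorem zPhase_zero_left (b : Bits n) : zPhase 0 b = 1 := by simp [zPhase]

theorem zPhase_mul_self (x b : Bits n) : zPhase x b * zPhase x b = 1 := by
  simp [zPhase_eq, ← mul_pow]

theorem star_zPhase (x b : Bits n) : star (zPhase x b) = zPhase x b := by
  simp [zPhase_eq]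

theorem xKet_eq (y a : Bits n) : xKet y a = zPhase y a * ((√2 : ℝ) : ℂ)⁻¹ ^ n := by
  simp [xKet, xKetBit, div_eq_mul_inv, Finset.prod_mul_distrib, zPhase]

theorem sum_neg_one_pow_val_mul (a : ZMod 2) :
    ∑ x : ZMod 2, (-1 : ℂ) ^ (x * a).val = if a = 0 then 2 else 0 := by
  rw [show (Finset.univ : Finset (ZMod 2)) = {0, 1} from rfl, Finset.sum_pair zero_ne_one]
  obtain rfl | rfl : a = 0 ∨ a = 1 := by revert a; decide
  · norm_num
  · simp [ZMod.val_one]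

theorem sum_zPhase (b : Bits n) : ∑ y, zPhase y b = if b = 0 then (2 : ℂ) ^ n else 0 := by
  calc ∑ y, zPhase y b = ∏ i, ∑ x : ZMod 2, (-1 : ℂ) ^ (x * b i).val := by
        rw [Fintype.prod_sum]
        rfl
    _ = ∏ i, if b i = 0 then (2 : ℂ) else 0 := by simp only [sum_neg_one_pow_val_mul]
    _ = if b = 0 then (2 : ℂ) ^ n else 0 := by
        rw [Finset.prod_ite_zero]
        simp [funext_iff]

theorem sum_zPhase_mul_zPhase (b b' : Bits n) :
    ∑ y, zPhase y b * zPhase y b' = if b = b' then (2 : ℂ) ^ n else 0 := by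
  simp only [← zPhase_add_right, sum_zPhase, add_eq_zero_iff_eq_neg, ZModModule.neg_eq_self]

theorem inv_sqrt_two_pow_mul_self (n : ℕ) :
    ((√2 : ℝ) : ℂ)⁻¹ ^ n * ((√2 : ℝ) : ℂ)⁻¹ ^ n = (2 ^ n)⁻¹ := by
  rw [← mul_pow, ← mul_inv, ← Complex.ofReal_mul, Real.mul_self_sqrt zero_le_two, inv_pow,
    Complex.ofReal_ofNat]

end Phase

section PhaseOp

variable {ι : Type*} [DecidableEq ι] {n : ℕ}

/-- The operator `Z^x` of `n` qubits in a larger system with basis `ι`, where `b p` are the bits of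
the basis vector `p`. -/
def phaseOp (b : ι → Bits n) (x : Bits n) : Matrix ι ι ℂ := Matrix.diagonal fun p => zPhase x (b p)

variable (b : ι → Bits n) (x : Bits n)

theorem isHermitian_phaseOp : (phaseOp b x).IsHermitian :=
  Matrix.isHermitian_diagonal_iff.2 fun p => star_zPhase x (b p)

theorem phaseOp_zero : phaseOp b 0 = 1 := by
  simp only [phaseOp, zPhase_zero_left, Matrix.diagonal_one]

variable [Fintype ι]

theorem phaseOp_conj_apply (M : Matrix ι ι ℂ) (p q : ι) :
    (phaseOp b x * M * phaseOp b x) p q = zPhase x (b p) * M p q * zPhase x (b q) := by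
  rw [phaseOp, Matrix.mul_diagonal, Matrix.diagonal_mul]

theorem phaseOp_mul_self : phaseOp b x * phaseOp b x = 1 := by
  simp only [phaseOp, Matrix.diagonal_mul_diagonal, zPhase_mul_self, Matrix.diagonal_one]

theorem phaseOp_mem_unitaryGroup : phaseOp b x ∈ Matrix.unitaryGroup ι ℂ := by
  rw [Matrix.mem_unitaryGroup_iff, Matrix.star_eq_conjTranspose, (isHermitian_phaseOp b x).eq,
    phaseOp_mul_self]

theorem cfc_phaseOp_conj (f : ℝ → ℝ) {M : Matrix ι ι ℂ} (hM : M.IsHermitian) :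
    cfc f (phaseOp b x * M * phaseOp b x) = phaseOp b x * cfc f M * phaseOp b x := by
  have h := cfc_unitary_conj f ⟨phaseOp b x, phaseOp_mem_unitaryGroup b x⟩ hM
  rwa [(isHermitian_phaseOp b x).eq] at h

theorem commute_phaseOp {b : ι → Bits n} {M : Matrix ι ι ℂ}
    (hM : ∀ p q, b p ≠ b q → M p q = 0) (x : Bits n) : Commute M (phaseOp b x) := by
  ext p q
  rw [phaseOp, Matrix.mul_diagonal, Matrix.diagonal_mul]
  by_cases h : b p = b q
  · rw [h, mul_comm]
  · rw [hM p q h, mul_zero, zero_mul]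

theorem sum_phaseOp_conj_apply (M : Matrix ι ι ℂ) (p q : ι) :
    (∑ x, phaseOp b x * M * phaseOp b x) p q = if b p = b q then 2 ^ n * M p q else 0 := by
  simp only [Matrix.sum_apply, phaseOp_conj_apply]
  calc ∑ x, zPhase x (b p) * M p q * zPhase x (b q)
      = (∑ x, zPhase x (b p) * zPhase x (b q)) * M p q := by
        simp only [Finset.sum_mul, mul_right_comm]
    _ = if b p = b q then 2 ^ n * M p q else 0 := by rw [sum_zPhase_mul_zPhase, ite_mul, zero_mul]

end PhaseOp

/-! ### Twisting operators -/

section Twist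

variable {r : ℕ} {K : Type*}

theorem twist_injective : Function.Injective (twist : (Bits r → Matrix K K ℂ) → _) :=
  fun V V' h => by
    ext ℓ s s'
    simpa [twist] using congrFun₂ h (ℓ, s) (ℓ, s')

theorem conjTranspose_twist (V : Bits r → Matrix K K ℂ) :
    (twist V)ᴴ = twist fun ℓ => (V ℓ)ᴴ := by
  ext p q
  by_cases h : p.1 = q.1
  · simp [twist, h]
  · simp [twist, h, Ne.symm h]

variable [Fintype K]

theorem twist_mul_apply (V : Bits r → Matrix K K ℂ) {κ : Type*} (M : Matrix (Bits r × K) κ ℂ)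
    (p : Bits r × K) (q : κ) :
    (twist V * M) p q = ∑ s, V p.1 p.2 s * M (p.1, s) q := by
  rw [Matrix.mul_apply, Fintype.sum_prod_type, Fintype.sum_eq_single p.1]
  · simp [twist]
  · intro b hb
    simp [twist, hb.symm]

theorem twist_mul (V V' : Bits r → Matrix K K ℂ) :
    twist V * twist V' = twist fun ℓ => V ℓ * V' ℓ := by
  ext p q
  rw [twist_mul_apply]
  by_cases h : p.1 = q.1 <;> simp [twist, h, Matrix.mul_apply]

theorem isStarProjection_of_twist {Q : Bits r → Matrix K K ℂ} (h : IsStarProjection (twist Q))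
    (ℓ : Bits r) : IsStarProjection (Q ℓ) where
  isIdempotentElem := congrFun (twist_injective ((twist_mul Q Q).symm.trans h.1)) ℓ
  isSelfAdjoint := congrFun (twist_injective ((conjTranspose_twist Q).symm.trans h.2)) ℓ

theorem exists_conjTranspose_mul_eq_submatrix {M : Matrix (Bits r × K) (Bits r × K) ℂ}
    (hM : 0 ≤ M) (hrank : M.rank ≤ Fintype.card K) :
    ∃ Y : Bits r → Matrix K K ℂ, ∀ ℓ ℓ', (Y ℓ)ᴴ * Y ℓ' = M.submatrix (Prod.mk ℓ) (Prod.mk ℓ') := by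
  obtain ⟨X, rfl⟩ := exists_conjTranspose_mul_self_of_rank_le hM hrank
  exact ⟨fun ℓ => X.submatrix id (Prod.mk ℓ), fun ℓ ℓ' => rfl⟩

variable [DecidableEq K]

theorem sum_phaseOp_fst_conj (M : Matrix (Bits r × K) (Bits r × K) ℂ) :
    ∑ y, phaseOp Prod.fst y * M * phaseOp Prod.fst y =
      twist fun ℓ => (2 ^ r : ℂ) • M.submatrix (Prod.mk ℓ) (Prod.mk ℓ) := by
  ext ⟨ℓ, s⟩ ⟨ℓ', s'⟩
  rw [sum_phaseOp_conj_apply, twist, Matrix.of_apply]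
  split_ifs with h
  · obtain rfl : ℓ = ℓ' := h
    rfl
  · rfl

theorem twist_conj_proj_apply (V : Bits r → Matrix K K ℂ) (f : Bits r → ℂ) (p q : Bits r × K) :
    (twist V * (proj f ⊗ₖ (1 : Matrix K K ℂ)) * (twist V)ᴴ) p q =
      f p.1 * star (f q.1) * (V p.1 * (V q.1)ᴴ) p.2 q.2 := by
  have hstar : twist V * (proj f ⊗ₖ (1 : Matrix K K ℂ)) * (twist V)ᴴ =
      twist V * (twist V * (proj f ⊗ₖ (1 : Matrix K K ℂ))ᴴ)ᴴ := by
    rw [Matrix.conjTranspose_mul, Matrix.conjTranspose_conjTranspose, Matrix.mul_assoc]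
  rw [hstar, twist_mul_apply, Matrix.mul_apply, Finset.mul_sum]
  refine Finset.sum_congr rfl fun s _ => ?_
  rw [Matrix.conjTranspose_apply, twist_mul_apply]
  simp [proj, Matrix.vecMulVec_apply, Matrix.one_apply]
  ring

theorem exists_unitary_conjTranspose_eq {Y Q : Matrix K K ℂ} {a : ℂ} (hQ : IsStarProjection Q)
    (h : Yᴴ * Y = (star a * a) • Q) :
    ∃ V ∈ Matrix.unitaryGroup K ℂ, Yᴴ = star a • (Q * V) := by
  have hQs : Qᴴ = Q := hQ.isSelfAdjoint
  have hQQ : Q * Q = Q := hQ.isIdempotentElem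
  obtain ⟨O, hO, hOY⟩ := exists_unitary_mul_eq (X := Y) (Y := a • Q) (by
    rw [h, Matrix.conjTranspose_smul, hQs, Matrix.smul_mul, Matrix.mul_smul, smul_smul, hQQ])
  refine ⟨Oᴴ, Unitary.star_mem hO, ?_⟩
  rw [← hOY, Matrix.conjTranspose_mul, Matrix.conjTranspose_smul, hQs, Matrix.smul_mul]

theorem exists_untwists {F : Bits r → Matrix (Bits r × K) (Bits r × K) ℂ}
    (hF : ∀ y, F y = phaseOp Prod.fst y * F 0 * phaseOp Prod.fst y) (h0 : 0 ≤ F 0)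
    (hQ : IsStarProjection (∑ y, F y)) (hrank : (F 0).rank ≤ Fintype.card K) :
    ∃ V : Bits r → Matrix K K ℂ, Untwists V F := by
  obtain ⟨Y, hY⟩ := exists_conjTranspose_mul_eq_submatrix h0 hrank
  set Q : Bits r → Matrix K K ℂ := fun ℓ => (2 ^ r : ℂ) • ((Y ℓ)ᴴ * Y ℓ) with hQdef
  have hsum : ∑ y, F y = twist Q := by
    rw [Finset.sum_congr rfl fun y _ => hF y, sum_phaseOp_fst_conj]
    simp only [hQdef, hY]
  rw [hsum] at hQ
  have hQℓ := isStarProjection_of_twist hQ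
  set a : ℂ := ((√2 : ℝ) : ℂ)⁻¹ ^ r
  have ha : star a = a := by simp [a]
  have hxKet : ∀ y ℓ : Bits r, xKet y ℓ = zPhase y ℓ * a := xKet_eq
  have hY' : ∀ ℓ, ∃ V ∈ Matrix.unitaryGroup K ℂ, (Y ℓ)ᴴ = a • (Q ℓ * V) := fun ℓ => by
    refine ha ▸ exists_unitary_conjTranspose_eq (hQℓ ℓ) ?_
    rw [ha, inv_sqrt_two_pow_mul_self, inv_smul_smul₀ (by positivity)]
  choose V hV hY' using hY'
  refine ⟨V, hV, fun y => ?_⟩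
  have hQV : (∑ y', F y') * twist V = twist fun ℓ => Q ℓ * V ℓ := by
    rw [hsum, twist_mul]
  have hQV' : (twist V)ᴴ * ∑ y', F y' = (twist fun ℓ => Q ℓ * V ℓ)ᴴ := by
    rw [← hQV, Matrix.conjTranspose_mul, hsum, ← Matrix.star_eq_conjTranspose (twist Q), hQ.2]
  rw [Matrix.mul_assoc, hQV', hQV]
  ext p q
  have hF0 : F 0 p q = ((Y p.1)ᴴ * (Y q.1)ᴴᴴ) p.2 q.2 := by
    rw [Matrix.conjTranspose_conjTranspose, hY]
    rfl
  rw [twist_conj_proj_apply, hF, phaseOp_conj_apply, hF0, hY', hY', Matrix.conjTranspose_smul, ha,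
    Matrix.smul_mul, Matrix.mul_smul, Matrix.smul_apply, Matrix.smul_apply, hxKet, hxKet,
    star_mul', star_zPhase, ha, smul_eq_mul, smul_eq_mul]
  ring

end Twist

/-! ### Distance of pure states -/

section Distance

theorem proj_sub_proj {ι : Type*} (a b : ι → ℂ) {t : ℝ} (ht : t ≠ 0) :
    proj a - proj b =
      proj ((1 / 2 : ℝ) • (t • (a - b) + t⁻¹ • (a + b))) -
        proj ((1 / 2 : ℝ) • (t • (a - b) - t⁻¹ • (a + b))) := by
  have ht' : (t : ℂ) * (t : ℂ)⁻¹ = 1 := mul_inv_cancel₀ (Complex.ofReal_ne_zero.2 ht)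
  ext i j
  simp only [proj, Matrix.sub_apply, Matrix.vecMulVec_apply, Pi.smul_apply, Pi.add_apply,
    Pi.sub_apply, Pi.star_apply, Complex.real_smul, star_mul', star_add, star_sub,
    Complex.star_def, Complex.conj_ofReal]
  push_cast
  linear_combination (-(a i * (starRingEnd ℂ) (a j)) + b i * (starRingEnd ℂ) (b j)) * ht'

theorem norm_half_smul_add_sq_add_norm_half_smul_sub_sq {V : Type*} [NormedAddCommGroup V]
    [InnerProductSpace ℝ V] (t : ℝ) (z w : V) :
    ‖(1 / 2 : ℝ) • (t • z + t⁻¹ • w)‖ ^ 2 + ‖(1 / 2 : ℝ) • (t • z - t⁻¹ • w)‖ ^ 2 =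
      (t ^ 2 * ‖z‖ ^ 2 + (t ^ 2)⁻¹ * ‖w‖ ^ 2) / 2 := by
  have h := parallelogram_law_with_norm ℝ (t • z) (t⁻¹ • w)
  have hz : ‖t • z‖ ^ 2 = t ^ 2 * ‖z‖ ^ 2 := by rw [norm_smul, mul_pow, Real.norm_eq_abs, sq_abs]
  have hw : ‖t⁻¹ • w‖ ^ 2 = (t ^ 2)⁻¹ * ‖w‖ ^ 2 := by
    rw [norm_smul, mul_pow, Real.norm_eq_abs, sq_abs, inv_pow]
  rw [norm_smul, norm_smul, mul_pow, mul_pow, Real.norm_of_nonneg (by norm_num)]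
  linear_combination (h + 2 * hz + 2 * hw) / 4

theorem proj_nonneg {ι : Type*} [Finite ι] (v : ι → ℂ) : 0 ≤ proj v :=
  (Matrix.posSemidef_vecMulVec_self_star v).nonneg

variable {ι : Type*} [Fintype ι]

theorem exists_proj_sub_proj_eq {a b : ι → ℂ} (ha : IsNormalized a) (hb : IsNormalized b) {D : ℝ}
    (hD : 0 < D) (h : ∑ i, ‖a i - b i‖ ^ 2 ≤ D ^ 2) :
    ∃ v w : ι → ℂ, proj a - proj b = proj v - proj w ∧
      ∑ i, ‖v i‖ ^ 2 + ∑ i, ‖w i‖ ^ 2 ≤ 2 * D := by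
  -- this `t` balances the contributions of `a - b` and `a + b`
  set t : ℝ := √(2 / D)
  have ht2 : t ^ 2 = 2 / D := Real.sq_sqrt (by positivity)
  have ht0 : t ≠ 0 := (Real.sqrt_pos.2 (by positivity)).ne'
  have hplus : ∑ i, ‖a i + b i‖ ^ 2 ≤ 4 := by
    calc ∑ i, ‖a i + b i‖ ^ 2 ≤ ∑ i, (2 * ‖a i‖ ^ 2 + 2 * ‖b i‖ ^ 2) :=
          Finset.sum_le_sum fun i _ => by
            nlinarith [parallelogram_law_with_norm ℝ (a i) (b i), sq_nonneg ‖a i - b i‖]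
      _ = 4 := by
          rw [Finset.sum_add_distrib, ← Finset.mul_sum, ← Finset.mul_sum, ha, hb]
          norm_num
  refine ⟨_, _, proj_sub_proj a b ht0, ?_⟩
  calc _ = (t ^ 2 * ∑ i, ‖a i - b i‖ ^ 2 + (t ^ 2)⁻¹ * ∑ i, ‖a i + b i‖ ^ 2) / 2 := by
        rw [← Finset.sum_add_distrib, Finset.mul_sum, Finset.mul_sum, ← Finset.sum_add_distrib,
          Finset.sum_div]
        exact Finset.sum_congr rfl fun i _ =>
          norm_half_smul_add_sq_add_norm_half_smul_sub_sq t _ _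
    _ ≤ (2 / D * D ^ 2 + (2 / D)⁻¹ * 4) / 2 := by
        rw [ht2]
        gcongr
    _ = 2 * D := by
        field_simp
        norm_num

theorem trace_proj_re (v : ι → ℂ) : (proj v).trace.re = ∑ i, ‖v i‖ ^ 2 := by
  simp only [proj, Matrix.trace_vecMulVec, dotProduct, Pi.star_apply, Complex.star_def,
    Complex.mul_conj, Complex.re_sum, Complex.ofReal_re, Complex.normSq_eq_norm_sq]

theorem traceNorm_proj_sub_proj_le [DecidableEq ι] {a b : ι → ℂ} (ha : IsNormalized a)
    (hb : IsNormalized b) {D : ℝ} (hD : 0 < D) (h : ∑ i, ‖a i - b i‖ ^ 2 ≤ D ^ 2) :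
    traceNorm (proj a - proj b) ≤ 2 * D := by
  obtain ⟨v, w, hvw, hle⟩ := exists_proj_sub_proj_eq ha hb hD h
  rw [hvw]
  refine (traceNorm_sub_le (proj_nonneg v) (proj_nonneg w)).trans ?_
  rwa [trace_proj_re, trace_proj_re]

end Distance

/-! ### Measured keys -/

section MeasuredKey

variable {r : ℕ} {K E : Type*} [Fintype K]

theorem measuredKey_nonneg [Finite E] (Ψ : Bits r × Bits r × K × E → ℂ) : 0 ≤ measuredKey Ψ := by
  have h : measuredKey Ψ = ∑ x : (Bits r × Bits r) × K,
      proj fun p => if p.1 = x.1.1 ∧ p.2.1 = x.1.2 then Ψ (p.1, p.2.1, x.2, p.2.2) else 0 := by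
    ext p q
    rw [Matrix.sum_apply, Fintype.sum_prod_type, Fintype.sum_eq_single (p.1, p.2.1)]
    · by_cases h : p.1 = q.1 ∧ p.2.1 = q.2.1
      · simp [measuredKey, proj, Matrix.vecMulVec_apply, h]
      · have h' : ¬(q.1 = p.1 ∧ q.2.1 = p.2.1) := fun h' => h ⟨h'.1.symm, h'.2.symm⟩
        simp [measuredKey, proj, Matrix.vecMulVec_apply, h, h']
    · intro b hb
      have hb' : ¬(p.1 = b.1 ∧ p.2.1 = b.2) := fun h => hb (Prod.ext h.1.symm h.2.symm)
      simp [proj, Matrix.vecMulVec_apply, hb']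
  rw [h]
  exact Finset.sum_nonneg fun x _ => proj_nonneg _

theorem measuredKey_sub_eq_of_proj_sub_eq {a b v w : Bits r × Bits r × K × E → ℂ}
    (h : proj a - proj b = proj v - proj w) :
    measuredKey a - measuredKey b = measuredKey v - measuredKey w := by
  ext p q
  simp only [measuredKey, Matrix.sub_apply, Matrix.of_apply]
  split_ifs
  · rw [← Finset.sum_sub_distrib, ← Finset.sum_sub_distrib]
    exact Finset.sum_congr rfl fun s _ => congrFun₂ h _ _
  · rfl

variable [Fintype E]

theorem trace_measuredKey_re (Ψ : Bits r × Bits r × K × E → ℂ) :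
    (measuredKey Ψ).trace.re = ∑ p, ‖Ψ p‖ ^ 2 := by
  simp only [measuredKey, Matrix.trace, Matrix.diag_apply, Matrix.of_apply, and_self, if_true,
    Complex.re_sum, Fintype.sum_prod_type, Complex.star_def, Complex.mul_conj, Complex.ofReal_re,
    Complex.normSq_eq_norm_sq]
  exact Finset.sum_congr rfl fun a _ => Finset.sum_congr rfl fun b _ => Finset.sum_comm

theorem traceNorm_measuredKey_sub_le [DecidableEq E] {a b : Bits r × Bits r × K × E → ℂ}
    (ha : IsNormalized a) (hb : IsNormalized b) {D : ℝ} (hD : 0 < D)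
    (h : ∑ p, ‖a p - b p‖ ^ 2 ≤ D ^ 2) : traceNorm (measuredKey a - measuredKey b) ≤ 2 * D := by
  obtain ⟨v, w, hvw, hle⟩ := exists_proj_sub_proj_eq ha hb hD h
  rw [measuredKey_sub_eq_of_proj_sub_eq hvw]
  refine (traceNorm_sub_le (measuredKey_nonneg v) (measuredKey_nonneg w)).trans ?_
  rwa [trace_measuredKey_re, trace_measuredKey_re]

end MeasuredKey

/-! ### Private states -/

section SharedKey

variable {L K E : Type*} [DecidableEq L]

/-- The vector `∑_b |b⟩_A |b⟩_B η_b`, where the amplitudes of `BK` and `E` form the matrix `η`. -/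
def sharedKey (η : Matrix (L × K) E ℂ) : L × L × K × E → ℂ := fun p =>
  if p.1 = p.2.1 then η (p.2.1, p.2.2.1) p.2.2.2 else 0

theorem sharedKey_sub (η θ : Matrix (L × K) E ℂ) :
    sharedKey (η - θ) = sharedKey η - sharedKey θ := by
  ext p
  by_cases h : p.1 = p.2.1 <;> simp [sharedKey, h]

theorem trace_conjTranspose_mul_self {ι κ : Type*} [Fintype ι] [Fintype κ]
    (M : Matrix ι κ ℂ) : (Mᴴ * M).trace = ((∑ i, ∑ j, ‖M i j‖ ^ 2 : ℝ) : ℂ) := by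
  rw [Finset.sum_comm]
  simp only [Matrix.trace, Matrix.diag_apply, Matrix.mul_apply, Matrix.conjTranspose_apply,
    Complex.star_def, Complex.conj_mul', Complex.ofReal_sum, Complex.ofReal_pow]

variable [Fintype L] [Fintype K] [Fintype E]

theorem sum_norm_sq_sharedKey (η : Matrix (L × K) E ℂ) :
    ∑ p, ‖sharedKey η p‖ ^ 2 = (ηᴴ * η).trace.re := by
  rw [trace_conjTranspose_mul_self, Complex.ofReal_re]
  simp only [Fintype.sum_prod_type, sharedKey]
  refine Finset.sum_congr rfl fun a _ => ?_
  rw [Fintype.sum_eq_single a fun b hb => by simp [hb.symm]]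
  simp

end SharedKey

section PrivateKey

variable {r : ℕ} {K E : Type*}

/-- The operator `⟨0̃|_B U†` from `BK` to `K`, for the twisting operator `U` of `V`. -/
def untwistRow (V : Bits r → Matrix K K ℂ) : Matrix K (Bits r × K) ℂ :=
  Matrix.of fun s p => ((√2 : ℝ) : ℂ)⁻¹ ^ r * star (V p.1 p.2 s)

theorem conjTranspose_untwistRow_apply (V : Bits r → Matrix K K ℂ) (p : Bits r × K) (s : K) :
    (untwistRow V)ᴴ p s = ((√2 : ℝ) : ℂ)⁻¹ ^ r * V p.1 p.2 s := by
  simp [untwistRow]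

variable [Fintype K]

theorem privateState_eq_sharedKey (V : Bits r → Matrix K K ℂ) (ξ : Matrix K E ℂ) :
    privateState V (fun p => ξ p.1 p.2) = sharedKey ((untwistRow V)ᴴ * ξ) := by
  funext p
  simp only [privateState, sharedKey]
  split_ifs with h
  · simp only [Matrix.mul_apply, Finset.mul_sum, conjTranspose_untwistRow_apply, mul_assoc, h]
  · rfl

variable [DecidableEq K]

theorem untwistRow_mul_conjTranspose {V : Bits r → Matrix K K ℂ}
    (hV : ∀ ℓ, V ℓ ∈ Matrix.unitaryGroup K ℂ) : untwistRow V * (untwistRow V)ᴴ = 1 := by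
  ext s s'
  have hblock : ∀ ℓ, ∑ k, untwistRow V s (ℓ, k) * (untwistRow V)ᴴ (ℓ, k) s' =
      (2 ^ r)⁻¹ * (1 : Matrix K K ℂ) s s' := fun ℓ => by
    rw [← Matrix.mem_unitaryGroup_iff'.1 (hV ℓ), Matrix.mul_apply, Finset.mul_sum,
      ← inv_sqrt_two_pow_mul_self]
    refine Finset.sum_congr rfl fun k _ => ?_
    rw [conjTranspose_untwistRow_apply, untwistRow, Matrix.of_apply, Matrix.star_apply]
    ring
  rw [Matrix.mul_apply, Fintype.sum_prod_type, Fintype.sum_congr _ _ hblock]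
  simp

theorem twist_conj_proj_xKet_zero (V : Bits r → Matrix K K ℂ) :
    twist V * (proj (xKet 0) ⊗ₖ (1 : Matrix K K ℂ)) * (twist V)ᴴ =
      (untwistRow V)ᴴ * untwistRow V := by
  ext p q
  rw [twist_conj_proj_apply, Matrix.mul_apply, Matrix.mul_apply, Finset.mul_sum]
  refine Finset.sum_congr rfl fun s _ => ?_
  rw [conjTranspose_untwistRow_apply, untwistRow, Matrix.of_apply, xKet_eq, xKet_eq,
    zPhase_zero_left, zPhase_zero_left, Matrix.conjTranspose_apply, one_mul, star_pow, star_inv₀,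
    Complex.star_def, Complex.conj_ofReal]
  ring

theorem measuredKey_privateState {V : Bits r → Matrix K K ℂ}
    (hV : ∀ ℓ, V ℓ ∈ Matrix.unitaryGroup K ℂ) (ξ : K × E → ℂ) :
    measuredKey (privateState V ξ) =
      secretKey r (Matrix.of fun e e' => ∑ s, ξ (s, e) * star (ξ (s, e'))) := by
  ext ⟨a, b, e⟩ ⟨a', b', e'⟩
  by_cases h : a = a' ∧ b = b'
  swap
  · simp [measuredKey, secretKey, h, ← and_assoc]
  obtain ⟨rfl, rfl⟩ := h
  by_cases hab : a = b
  swap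
  · simp [measuredKey, secretKey, privateState, hab]
  subst hab
  set X : Matrix K E ℂ := Matrix.of fun s e => ξ (s, e) with hX
  have hVX : (V a * X)ᴴ * (V a * X) = Xᴴ * X := by
    rw [Matrix.conjTranspose_mul, Matrix.mul_assoc, ← Matrix.mul_assoc _ (V a),
      ← Matrix.star_eq_conjTranspose (V a), Matrix.mem_unitaryGroup_iff'.1 (hV a), Matrix.one_mul]
  have hVX' := congrFun₂ hVX e' e
  simp only [Matrix.mul_apply, Matrix.conjTranspose_apply, hX, Matrix.of_apply] at hVX'
  have hscale : star (((√2 : ℝ) : ℂ)⁻¹ ^ r) = ((√2 : ℝ) : ℂ)⁻¹ ^ r := by simp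
  simp only [measuredKey, secretKey, privateState, Matrix.of_apply, and_self, if_true]
  rw [one_div, inv_pow 2, ← inv_sqrt_two_pow_mul_self,
    Finset.sum_congr rfl fun s _ => mul_comm (ξ (s, e)) _, ← hVX', Finset.mul_sum]
  refine Finset.sum_congr rfl fun s _ => ?_
  rw [star_mul', hscale]
  ring

theorem isEpsPrivate_of_close [DecidableEq E] [Fintype E] {V : Bits r → Matrix K K ℂ}
    (hV : ∀ ℓ, V ℓ ∈ Matrix.unitaryGroup K ℂ) {ξ : K × E → ℂ} (hξ : IsNormalized ξ)
    {Ψ : Bits r × Bits r × K × E → ℂ} (hΨ : IsNormalized Ψ)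
    (hγ : IsNormalized (privateState V ξ)) {D : ℝ} (hD : 0 < D)
    (h : ∑ p, ‖Ψ p - privateState V ξ p‖ ^ 2 ≤ D ^ 2) : IsEpsPrivate D Ψ := by
  refine ⟨Matrix.of fun e e' => ∑ s, ξ (s, e) * star (ξ (s, e')), ?_, ?_, ?_⟩
  · exact Matrix.posSemidef_self_mul_conjTranspose (Matrix.of fun e s => ξ (s, e))
  · rw [IsNormalized, Fintype.sum_prod_type, Finset.sum_comm] at hξ
    simp only [Matrix.trace, Matrix.diag_apply, Matrix.of_apply, Complex.star_def,
      Complex.mul_conj, Complex.normSq_eq_norm_sq]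
    exact_mod_cast hξ
  · rw [← measuredKey_privateState hV]
    exact traceNorm_measuredKey_sub_le hΨ hγ hD h

end PrivateKey

section Decoupling

variable {ι K E : Type*} [Fintype ι] [Fintype K] [Fintype E] [DecidableEq K]

theorem trace_sub_conjTranspose_mul_self_re {B : Matrix K ι ℂ} (hB : B * Bᴴ = 1)
    (η : Matrix ι E ℂ) (ξ : Matrix K E ℂ) :
    ((η - Bᴴ * ξ)ᴴ * (η - Bᴴ * ξ)).trace.re =
      (ηᴴ * η).trace.re + (ξᴴ * ξ).trace.re - 2 * ((B * η)ᴴ * ξ).trace.re := by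
  have hcross : ηᴴ * (Bᴴ * ξ) = (B * η)ᴴ * ξ := by
    rw [Matrix.conjTranspose_mul, Matrix.mul_assoc]
  have hcross' : (Bᴴ * ξ)ᴴ * η = ((B * η)ᴴ * ξ)ᴴ := by
    rw [← hcross, Matrix.conjTranspose_mul ηᴴ, Matrix.conjTranspose_conjTranspose]
  have hiso : (Bᴴ * ξ)ᴴ * (Bᴴ * ξ) = ξᴴ * ξ := by
    rw [Matrix.conjTranspose_mul, Matrix.conjTranspose_conjTranspose, Matrix.mul_assoc,
      ← Matrix.mul_assoc B, hB, Matrix.one_mul]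
  rw [Matrix.conjTranspose_sub, Matrix.sub_mul, Matrix.mul_sub, Matrix.mul_sub, hcross, hcross',
    hiso]
  simp only [Matrix.trace_sub, Complex.sub_re, Matrix.trace_conjTranspose, Complex.star_def,
    Complex.conj_re]
  ring

theorem isStarProjection_conjTranspose_mul_self {B : Matrix K ι ℂ} (hB : B * Bᴴ = 1) :
    IsStarProjection (Bᴴ * B) :=
  ⟨by rw [IsIdempotentElem, Matrix.mul_assoc, ← Matrix.mul_assoc B, hB, Matrix.one_mul],
    Matrix.isHermitian_conjTranspose_mul_self B⟩

theorem exists_normalized_trace_sub_le {B : Matrix K ι ℂ} (hB : B * Bᴴ = 1)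
    {η : Matrix ι E ℂ} (hη : (ηᴴ * η).trace.re = 1) {t : ℝ} (ht : 0 < t)
    (h : t ≤ (η * ηᴴ * (Bᴴ * B)).trace.re) :
    ∃ ξ : Matrix K E ℂ, (ξᴴ * ξ).trace.re = 1 ∧
      ((η - Bᴴ * ξ)ᴴ * (η - Bᴴ * ξ)).trace.re ≤ 2 * (1 - t) := by
  classical
  set z := (η * ηᴴ * (Bᴴ * B)).trace.re with hz
  have hzB : ((B * η)ᴴ * (B * η)).trace.re = z := by
    rw [hz, Matrix.conjTranspose_mul, Matrix.mul_assoc, Matrix.trace_mul_comm ηᴴ,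
      Matrix.trace_mul_comm (η * ηᴴ)]
    simp only [Matrix.mul_assoc]
  have hz_pos : 0 < z := ht.trans_le h
  have hz_le : z ≤ 1 := by
    have h1 := trace_mul_re_mono (Matrix.posSemidef_self_mul_conjTranspose η).nonneg
      (isStarProjection_conjTranspose_mul_self hB).le_one
    rwa [Matrix.mul_one, Matrix.trace_mul_comm η, hη] at h1
  have hsqrt : √z ≠ 0 := (Real.sqrt_pos.2 hz_pos).ne'
  have hcross : ((B * η)ᴴ * ((√z)⁻¹ • (B * η))).trace.re = √z := by
    rw [Matrix.mul_smul, Matrix.trace_smul, Complex.smul_re, hzB, smul_eq_mul]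
    field_simp
    exact (Real.sq_sqrt hz_pos.le).symm
  have hξ : (((√z)⁻¹ • (B * η))ᴴ * ((√z)⁻¹ • (B * η))).trace.re = 1 := by
    rw [Matrix.conjTranspose_smul, star_trivial, Matrix.smul_mul, Matrix.trace_smul,
      Complex.smul_re, hcross, smul_eq_mul, inv_mul_cancel₀ hsqrt]
  refine ⟨(√z)⁻¹ • (B * η), hξ, ?_⟩
  have hz_sqrt : z ≤ √z := Real.le_sqrt_of_sq_le (by nlinarith)
  rw [trace_sub_conjTranspose_mul_self_re hB, hη, hξ, hcross]
  linarith

end Decoupling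

theorem exists_close_privateState {r : ℕ} {K E : Type*} [Fintype K] [Fintype E] [DecidableEq K]
    {V : Bits r → Matrix K K ℂ} {F : Bits r → Matrix (Bits r × K) (Bits r × K) ℂ}
    (hV : Untwists V F) (hQ : IsStarProjection (∑ y, F y)) {η : Matrix (Bits r × K) E ℂ}
    (hη : (ηᴴ * η).trace.re = 1) {e : ℝ} (he : e < 1 / 2)
    (hF : 1 - e ≤ (η * ηᴴ * F 0).trace.re) :
    ∃ ξ : K × E → ℂ, IsNormalized ξ ∧ IsNormalized (privateState V ξ) ∧
      ∑ p, ‖sharedKey η p - privateState V ξ p‖ ^ 2 ≤ 4 * e := by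
  set B := untwistRow V with hB_def
  have hB : B * Bᴴ = 1 := untwistRow_mul_conjTranspose hV.1
  have hF0 : F 0 = (∑ y, F y) * (Bᴴ * B) * ∑ y, F y := by
    rw [hB_def, ← twist_conj_proj_xKet_zero]
    refine (hV.2 0).trans ?_
    simp only [Matrix.mul_assoc]
  have hoverlap : 1 - 2 * e ≤ (η * ηᴴ * (Bᴴ * B)).trace.re := by
    have h := trace_mul_re_mono (Matrix.posSemidef_self_mul_conjTranspose η).nonneg
      (one_sub_le_two_nsmul_one_sub_conj hQ (isStarProjection_conjTranspose_mul_self hB))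
    rw [← hF0, two_nsmul, mul_sub, mul_add, mul_sub, Matrix.trace_sub, Matrix.trace_add,
      Matrix.trace_sub, Matrix.mul_one, Matrix.trace_mul_comm η ηᴴ, Complex.sub_re,
      Complex.add_re, Complex.sub_re, hη] at h
    linarith
  obtain ⟨ξ, hξ, hclose⟩ := exists_normalized_trace_sub_le hB hη (by linarith) hoverlap
  refine ⟨fun p => ξ p.1 p.2, ?_, ?_, ?_⟩
  · rw [IsNormalized, Fintype.sum_prod_type, ← hξ, trace_conjTranspose_mul_self, Complex.ofReal_re]
  · rw [IsNormalized, privateState_eq_sharedKey, sum_norm_sq_sharedKey, Matrix.conjTranspose_mul,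
      Matrix.conjTranspose_conjTranspose, Matrix.mul_assoc, ← Matrix.mul_assoc B, hB,
      Matrix.one_mul, hξ]
  · simp only [privateState_eq_sharedKey, ← Pi.sub_apply, ← sharedKey_sub, sum_norm_sq_sharedKey]
    linarith

/-! ### Entropy -/

section Entropy

variable {ι κ : Type*} [Fintype ι] [DecidableEq ι] [Fintype κ] [DecidableEq κ]

theorem entropy_spectralHom (W : Matrix.unitaryGroup ι ℂ) (p : ι → ℝ) :
    entropy (spectralHom W p) = (∑ i, Real.negMulLog (p i)) / Real.log 2 := by
  rw [entropy, cfc_spectralHom, trace_spectralHom, Complex.ofReal_re]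
  rfl

theorem entropy_unitary_conj (W : Matrix.unitaryGroup ι ℂ) {A : Matrix ι ι ℂ}
    (hA : A.IsHermitian) :
    entropy ((W : Matrix ι ι ℂ) * A * (W : Matrix ι ι ℂ)ᴴ) = entropy A := by
  rw [entropy, cfc_unitary_conj _ _ hA, Matrix.trace_mul_cycle, ← Matrix.star_eq_conjTranspose,
    Matrix.UnitaryGroup.star_mul_self, Matrix.one_mul, entropy]

theorem aeval_conjTranspose_mul_self_mul (X : Matrix ι κ ℂ) (q : Polynomial ℝ) :
    Polynomial.aeval (Xᴴ * X) q * Xᴴ = Xᴴ * Polynomial.aeval (X * Xᴴ) q := by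
  induction q using Polynomial.induction_on' with
  | add q₁ q₂ h₁ h₂ => simp only [map_add, Matrix.add_mul, Matrix.mul_add, h₁, h₂]
  | monomial n a =>
    have hpow : (Xᴴ * X) ^ n * Xᴴ = Xᴴ * (X * Xᴴ) ^ n := by
      induction n with
      | zero => simp
      | succ n ih => rw [pow_succ', Matrix.mul_assoc, ih, pow_succ']; simp only [Matrix.mul_assoc]
    simp only [Polynomial.aeval_monomial, Algebra.algebraMap_eq_smul_one, smul_mul_assoc, one_mul,
      Matrix.smul_mul, Matrix.mul_smul, hpow]

theorem trace_cfc_conjTranspose_mul_self (X : Matrix ι κ ℂ) {f : ℝ → ℝ} (hf : f 0 = 0) :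
    (cfc f (Xᴴ * X)).trace = (cfc f (X * Xᴴ)).trace := by
  set G : Finset ℝ := insert 0 ((Matrix.finite_real_spectrum (A := Xᴴ * X)).toFinset ∪
    (Matrix.finite_real_spectrum (A := X * Xᴴ)).toFinset) with hG
  set p : Polynomial ℝ := Lagrange.interpolate G id f
  have hp : ∀ t ∈ G, f t = p.eval t := fun t ht =>
    (Lagrange.eval_interpolate_at_node (v := id) f (Set.injOn_id _) ht).symm
  obtain ⟨q, hq⟩ : Polynomial.X ∣ p := by
    rw [Polynomial.X_dvd_iff, Polynomial.coeff_zero_eq_eval_zero, ← hp 0 (by simp [hG]), hf]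
  have hXX : cfc f (Xᴴ * X) = Polynomial.aeval (Xᴴ * X) p :=
    (cfc_congr fun t ht => hp t (by simp [hG, ht])).trans
      (cfc_polynomial p _ (Matrix.isHermitian_conjTranspose_mul_self X))
  have hXX' : cfc f (X * Xᴴ) = Polynomial.aeval (X * Xᴴ) p :=
    (cfc_congr fun t ht => hp t (by simp [hG, ht])).trans
      (cfc_polynomial p _ (Matrix.isHermitian_mul_conjTranspose_self X))
  rw [hXX, hXX', hq, mul_comm Polynomial.X, map_mul, map_mul, Polynomial.aeval_X,
    Polynomial.aeval_X, ← Matrix.mul_assoc, aeval_conjTranspose_mul_self_mul,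
    Matrix.trace_mul_comm, ← Matrix.mul_assoc, Matrix.trace_mul_comm]

theorem entropy_conjTranspose_mul_self (X : Matrix ι κ ℂ) :
    entropy (Xᴴ * X) = entropy (X * Xᴴ) := by
  rw [entropy, entropy, trace_cfc_conjTranspose_mul_self X Real.negMulLog_zero]

theorem sum_norm_sq_row (W : Matrix.unitaryGroup ι ℂ) (i : ι) : ∑ j, ‖W i j‖ ^ 2 = 1 := by
  have h := congrFun₂ (Matrix.mem_unitaryGroup_iff.1 W.2) i i
  simp only [Matrix.mul_apply, Matrix.star_apply, Complex.star_def, Complex.mul_conj,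
    Complex.normSq_eq_norm_sq, Matrix.one_apply_eq] at h
  exact_mod_cast h

theorem sum_norm_sq_col (W : Matrix.unitaryGroup ι ℂ) (j : ι) : ∑ i, ‖W i j‖ ^ 2 = 1 := by
  simpa [Matrix.star_apply] using sum_norm_sq_row (star W) j

theorem spectralHom_apply_apply (W : Matrix.unitaryGroup ι ℂ) (d : ι → ℝ) (i k : ι) :
    spectralHom W d i k = ∑ j, W i j * d j * star (W k j) := by
  simp only [spectralHom_apply, Matrix.mul_apply (M := _ * _), Matrix.mul_diagonal,
    Matrix.conjTranspose_apply]

theorem spectralHom_diag_re (W : Matrix.unitaryGroup ι ℂ) (d : ι → ℝ) (i : ι) :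
    (spectralHom W d i i).re = ∑ j, ‖W i j‖ ^ 2 * d j := by
  rw [spectralHom_apply_apply, Complex.re_sum]
  refine Finset.sum_congr rfl fun j _ => ?_
  rw [mul_right_comm, Complex.star_def, Complex.mul_conj, ← Complex.ofReal_mul, Complex.ofReal_re,
    Complex.normSq_eq_norm_sq]

theorem entropy_le_sum_negMulLog_diag {σ : Matrix ι ι ℂ} (hσ : 0 ≤ σ) :
    entropy σ ≤ (∑ i, Real.negMulLog (σ i i).re) / Real.log 2 := by
  obtain ⟨W, q, hq, rfl⟩ := exists_eq_spectralHom_nonneg hσ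
  have hjensen : ∀ i, ∑ j, ‖W i j‖ ^ 2 * Real.negMulLog (q j) ≤
      Real.negMulLog (spectralHom W q i i).re := fun i => by
    rw [spectralHom_diag_re]
    exact Real.concaveOn_negMulLog.le_map_sum (t := Finset.univ) (fun j _ => sq_nonneg _)
      (sum_norm_sq_row W i) (fun j _ => hq j)
  rw [entropy_spectralHom]
  refine div_le_div_of_nonneg_right ?_ (Real.log_nonneg one_le_two)
  calc ∑ j, Real.negMulLog (q j) = ∑ j, ∑ i, ‖W i j‖ ^ 2 * Real.negMulLog (q j) := by
        simp only [← Finset.sum_mul, sum_norm_sq_col, one_mul]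
    _ = ∑ i, ∑ j, ‖W i j‖ ^ 2 * Real.negMulLog (q j) := Finset.sum_comm
    _ ≤ _ := Finset.sum_le_sum fun i _ => hjensen i

theorem entropy_smul (a : ℝ) {σ : Matrix ι ι ℂ} (hσ : σ.IsHermitian) :
    entropy (a • σ) = a * entropy σ + Real.negMulLog a / Real.log 2 * σ.trace.re := by
  obtain ⟨W, p, rfl⟩ := exists_eq_spectralHom hσ
  rw [← map_smul, entropy_spectralHom, entropy_spectralHom, trace_spectralHom, Complex.ofReal_re]
  simp only [Pi.smul_apply, smul_eq_mul, Real.negMulLog_mul, Finset.sum_add_distrib,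
    ← Finset.mul_sum, ← Finset.sum_mul]
  ring

theorem concaveOn_entropy : ConcaveOn ℝ {σ : Matrix ι ι ℂ | 0 ≤ σ} entropy := by
  refine ⟨convex_Ici 0, fun σ hσ τ hτ a b ha hb hab => ?_⟩
  obtain ⟨W, p, h⟩ := exists_eq_spectralHom (Matrix.nonneg_iff_posSemidef.1
    (add_nonneg (smul_nonneg ha hσ) (smul_nonneg hb hτ))).1
  set D : Matrix ι ι ℂ → ι → ℝ := fun A i => ((star (W : Matrix ι ι ℂ) * A * W) i i).re with hD
  have hD0 : ∀ {A}, 0 ≤ A → ∀ i, 0 ≤ D A i := fun hA i =>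
    (Complex.le_def.1 ((Matrix.nonneg_iff_posSemidef.1
      (star_left_conjugate_nonneg hA (W : Matrix ι ι ℂ))).diag_nonneg (i := i))).1
  have hle : ∀ {A}, 0 ≤ A → entropy A ≤ (∑ i, Real.negMulLog (D A i)) / Real.log 2 := fun hA => by
    have hconj := entropy_unitary_conj (star W) (IsSelfAdjoint.of_nonneg hA)
    rw [← Matrix.star_eq_conjTranspose, Unitary.coe_star, star_star] at hconj
    exact hconj.symm.trans_le
      (entropy_le_sum_negMulLog_diag (star_left_conjugate_nonneg hA (W : Matrix ι ι ℂ)))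
  have hp : ∀ i, p i = a * D σ i + b * D τ i := fun i => by
    have hW : star (W : Matrix ι ι ℂ) * spectralHom W p * W =
        Matrix.diagonal fun i => (p i : ℂ) := by
      rw [spectralHom_apply, ← Matrix.star_eq_conjTranspose]
      simp only [Matrix.mul_assoc, Matrix.UnitaryGroup.star_mul_self, Matrix.mul_one]
      rw [← Matrix.mul_assoc, Matrix.UnitaryGroup.star_mul_self, Matrix.one_mul]
    have hi : D (a • σ + b • τ) i = p i := by simp only [hD, h, hW]; simp
    simpa [hD, Matrix.mul_add, Matrix.add_mul] using hi.symm
  have hmix : ∀ i, a * Real.negMulLog (D σ i) + b * Real.negMulLog (D τ i) ≤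
      Real.negMulLog (p i) := fun i =>
    hp i ▸ Real.concaveOn_negMulLog.2 (hD0 hσ i) (hD0 hτ i) ha hb hab
  have : 0 ≤ Real.log 2 := Real.log_nonneg one_le_two
  calc a * entropy σ + b * entropy τ
      ≤ a * ((∑ i, Real.negMulLog (D σ i)) / Real.log 2) +
        b * ((∑ i, Real.negMulLog (D τ i)) / Real.log 2) := by
        gcongr <;> exact hle ‹_›
    _ = (∑ i, (a * Real.negMulLog (D σ i) + b * Real.negMulLog (D τ i))) / Real.log 2 := by
        rw [Finset.sum_add_distrib, ← Finset.mul_sum, ← Finset.mul_sum]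
        ring
    _ ≤ (∑ i, Real.negMulLog (p i)) / Real.log 2 := by
        gcongr with i
        exact hmix i
    _ = entropy (a • σ + b • τ) := by rw [h, entropy_spectralHom]

theorem entropy_sum_le {X : Type*} [Fintype X] {σ : X → Matrix ι ι ℂ} (hσ : ∀ x, 0 ≤ σ x) :
    entropy (∑ x, σ x) ≤ ∑ x, entropy (σ x) := by
  classical
  choose W q hq hWq using fun x => exists_eq_spectralHom_nonneg (hσ x)
  let Y : Matrix (X × ι) ι ℂ := Matrix.of fun p i => star (W p.1 i p.2 * (√(q p.1 p.2) : ℝ))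
  have hsum : ∑ x, σ x = Yᴴ * Y := by
    ext i k
    simp only [hWq, Matrix.sum_apply, spectralHom_apply_apply, Matrix.mul_apply,
      Matrix.conjTranspose_apply, Fintype.sum_prod_type, Y, Matrix.of_apply, star_star]
    refine Finset.sum_congr rfl fun x _ => Finset.sum_congr rfl fun j _ => ?_
    nth_rw 1 [← Real.mul_self_sqrt (hq x j)]
    rw [star_mul', Complex.star_def, Complex.conj_ofReal, Complex.ofReal_mul]
    ring
  have hdiag : ∀ x j, ((Y * Yᴴ) (x, j) (x, j)).re = q x j := fun x j => by
    have h : (Y * Yᴴ) (x, j) (x, j) = ∑ i, ((‖W x i j‖ ^ 2 * q x j : ℝ) : ℂ) := by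
      refine Finset.sum_congr rfl fun i _ => ?_
      change star _ * star (star _) = _
      rw [star_star, Complex.star_def, mul_comm, Complex.mul_conj, Complex.normSq_eq_norm_sq,
        norm_mul, mul_pow, Complex.norm_real, Real.norm_eq_abs, sq_abs, Real.sq_sqrt (hq x j)]
    rw [h, ← Complex.ofReal_sum, ← Finset.sum_mul, sum_norm_sq_col, one_mul, Complex.ofReal_re]
  calc entropy (∑ x, σ x) = entropy (Y * Yᴴ) := by rw [hsum, entropy_conjTranspose_mul_self]
    _ ≤ (∑ p : X × ι, Real.negMulLog ((Y * Yᴴ) p p).re) / Real.log 2 :=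
        entropy_le_sum_negMulLog_diag
          (Matrix.posSemidef_self_mul_conjTranspose Y).nonneg
    _ = ∑ x, entropy (σ x) := by
        simp only [Fintype.sum_prod_type, hdiag, hWq, entropy_spectralHom, Finset.sum_div]

theorem entropy_le_logb_card {σ : Matrix ι ι ℂ} (hσ : 0 ≤ σ) (h1 : σ.trace = 1) :
    entropy σ ≤ Real.logb 2 (Fintype.card ι) := by
  obtain ⟨W, p, hp, rfl⟩ := exists_eq_spectralHom_nonneg hσ
  have hp1 : ∑ i, p i = 1 := by rw [trace_spectralHom] at h1; exact_mod_cast h1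
  have : Nonempty ι :=
    Finset.univ_nonempty_iff.1 (Finset.nonempty_of_sum_ne_zero (hp1 ▸ one_ne_zero))
  have hd : (0 : ℝ) < Fintype.card ι := by exact_mod_cast Fintype.card_pos
  have hjensen := Real.concaveOn_negMulLog.le_map_sum (t := Finset.univ)
    (w := fun _ : ι => (Fintype.card ι : ℝ)⁻¹) (p := p) (fun _ _ => (inv_pos.2 hd).le)
    (by simp [hd.ne']) fun i _ => hp i
  simp only [smul_eq_mul, ← Finset.mul_sum, hp1, mul_one] at hjensen
  rw [Real.negMulLog, Real.log_inv, neg_mul_neg, mul_le_mul_iff_right₀ (inv_pos.2 hd)] at hjensen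
  rw [entropy_spectralHom, Real.logb]
  exact div_le_div_of_nonneg_right hjensen (Real.log_nonneg one_le_two)

theorem holevo_eq (ρ : ZMod 2 → Matrix ι ι ℂ) :
    holevo ρ = entropy ((1 / 2 : ℝ) • ρ 0 + (1 / 2 : ℝ) • ρ 1) -
      (1 / 2 * entropy (ρ 0) + 1 / 2 * entropy (ρ 1)) := by
  have h : (1 / 2 : ℂ) = ((1 / 2 : ℝ) : ℂ) := by norm_num
  rw [holevo, h, Complex.coe_smul, ← smul_add, ← mul_add]
  congr 3 <;> exact Fin.sum_univ_two _

theorem holevo_nonneg {ρ : ZMod 2 → Matrix ι ι ℂ} (hρ : ∀ x, 0 ≤ ρ x) : 0 ≤ holevo ρ := by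
  rw [holevo_eq, sub_nonneg]
  exact concaveOn_entropy.2 (hρ 0) (hρ 1) (by norm_num) (by norm_num) (by norm_num)

theorem holevo_le_one {ρ : ZMod 2 → Matrix ι ι ℂ} (hρ : ∀ x, 0 ≤ ρ x)
    (h1 : ∀ x, (ρ x).trace = 1) : holevo ρ ≤ 1 := by
  have hx : ∀ x, entropy ((1 / 2 : ℝ) • ρ x) = 1 / 2 * entropy (ρ x) + 1 / 2 := fun x => by
    rw [entropy_smul _ (IsSelfAdjoint.of_nonneg (hρ x)), h1, Complex.one_re, mul_one,
      Real.negMulLog, one_div, Real.log_inv, neg_mul_neg, mul_div_assoc,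
      div_self (Real.log_pos one_lt_two).ne', mul_one]
  have h := entropy_sum_le (σ := fun x => (1 / 2 : ℝ) • ρ x)
    fun x => smul_nonneg (by norm_num) (hρ x)
  rw [show ∑ x, (1 / 2 : ℝ) • ρ x = (1 / 2 : ℝ) • ρ 0 + (1 / 2 : ℝ) • ρ 1 from Fin.sum_univ_two _,
    show ∑ x, entropy ((1 / 2 : ℝ) • ρ x) = _ from Fin.sum_univ_two _] at h
  change _ ≤ entropy ((1 / 2 : ℝ) • ρ 0) + entropy ((1 / 2 : ℝ) • ρ 1) at h
  rw [holevo_eq]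
  linarith [hx 0, hx 1]

end Entropy

/-! ### Tensor powers and typical subspaces -/

section Tensor

/-- The tensor power `M^{⊗n}`. -/
def tensorPow {ι κ : Type*} (n : ℕ) (M : Matrix ι κ ℂ) : Matrix (Fin n → ι) (Fin n → κ) ℂ :=
  Matrix.of fun p q => ∏ i, M (p i) (q i)

variable {ι κ : Type*}

theorem conjTranspose_tensorPow (n : ℕ) (A : Matrix ι κ ℂ) :
    (tensorPow n A)ᴴ = tensorPow n Aᴴ := by
  ext p q
  simp [tensorPow]

theorem tensorPow_diagonal [DecidableEq ι] (n : ℕ) (d : ι → ℂ) :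
    tensorPow n (Matrix.diagonal d) = Matrix.diagonal fun j => ∏ i, d (j i) := by
  ext p q
  simp only [tensorPow, Matrix.of_apply, Matrix.diagonal_apply]
  split_ifs with h
  · simp [h]
  · obtain ⟨i, hi⟩ := Function.ne_iff.1 h
    exact Finset.prod_eq_zero (Finset.mem_univ i) (if_neg hi)

theorem tensorPow_one [DecidableEq ι] (n : ℕ) : tensorPow n (1 : Matrix ι ι ℂ) = 1 := by
  rw [← Matrix.diagonal_one, tensorPow_diagonal]
  simp

theorem tensorPow_mul {ν : Type*} [Fintype κ] (n : ℕ) (A : Matrix ι κ ℂ) (B : Matrix κ ν ℂ) :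
    tensorPow n (A * B) = tensorPow n A * tensorPow n B := by
  ext p q
  simp only [tensorPow, Matrix.mul_apply, Matrix.of_apply, ← Finset.prod_mul_distrib,
    Finset.prod_univ_sum, Fintype.piFinset_univ]

variable [Fintype ι]

theorem trace_tensorPow (n : ℕ) (A : Matrix ι ι ℂ) : (tensorPow n A).trace = A.trace ^ n := by
  simp only [Matrix.trace, Matrix.diag_apply, tensorPow, Matrix.of_apply]
  rw [Finset.sum_pow', Fintype.piFinset_univ]

variable [DecidableEq ι]

theorem tensorPow_mem_unitaryGroup (n : ℕ) (W : Matrix.unitaryGroup ι ℂ) :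
    tensorPow n (W : Matrix ι ι ℂ) ∈ Matrix.unitaryGroup (Fin n → ι) ℂ := by
  rw [Matrix.mem_unitaryGroup_iff, Matrix.star_eq_conjTranspose, conjTranspose_tensorPow,
    ← tensorPow_mul, ← Matrix.star_eq_conjTranspose, Matrix.mem_unitaryGroup_iff.1 W.2,
    tensorPow_one]

theorem tensorPow_spectralHom (n : ℕ) (W : Matrix.unitaryGroup ι ℂ) (p : ι → ℝ) :
    tensorPow n (spectralHom W p) =
      spectralHom ⟨tensorPow n (W : Matrix ι ι ℂ), tensorPow_mem_unitaryGroup n W⟩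
        fun j => ∏ i, p (j i) := by
  rw [spectralHom_apply W, tensorPow_mul, tensorPow_mul, tensorPow_diagonal,
    ← conjTranspose_tensorPow]
  refine Eq.trans ?_ (spectralHom_apply _ _).symm
  simp only [Complex.ofReal_prod]

theorem tensorPow_nonneg [Finite κ] (n : ℕ) {A : Matrix κ κ ℂ} (hA : 0 ≤ A) :
    0 ≤ tensorPow n A := by
  classical
  have := Fintype.ofFinite κ
  obtain ⟨C, rfl⟩ := CStarAlgebra.nonneg_iff_eq_star_mul_self.1 hA
  rw [tensorPow_mul, Matrix.star_eq_conjTranspose, ← conjTranspose_tensorPow]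
  exact star_mul_self_nonneg _

end Tensor

section Typical

/-- The eigenvalues of a state of `n` systems that are typical for the entropy `s` per system, so
that `typicalProj n s δ` is the spectral projection onto `typicalSet n s δ`. -/
def typicalSet (n : ℕ) (s δ : ℝ) : Set ℝ :=
  Set.Icc ((2 : ℝ) ^ (-(n * (s + δ)))) ((2 : ℝ) ^ (-(n * (s - δ))))

theorem mem_typicalSet_iff {n : ℕ} {s δ t : ℝ} (ht : 0 < t) :
    t ∈ typicalSet n s δ ↔ |-Real.logb 2 t - n * s| ≤ n * δ := by
  rw [typicalSet, Set.mem_Icc, ← Real.le_logb_iff_rpow_le one_lt_two ht,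
    ← Real.logb_le_iff_le_rpow one_lt_two ht, abs_le]
  constructor <;> rintro ⟨h₁, h₂⟩ <;> constructor <;> linarith

theorem indicator_typicalSet_le {t : ℝ} (ht : 0 ≤ t) (n : ℕ) (s δ : ℝ) :
    (typicalSet n s δ).indicator 1 t ≤ 2 ^ (n * (s + δ)) * t := by
  have h0 : (0 : ℝ) < 2 ^ (n * (s + δ)) := by positivity
  by_cases h : t ∈ typicalSet n s δ
  · have h1 := mul_le_mul_of_nonneg_left h.1 h0.le
    rw [Real.rpow_neg zero_le_two, mul_inv_cancel₀ h0.ne'] at h1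
    simpa [h] using h1
  · simpa [h] using mul_nonneg h0.le ht

variable {ι : Type*}

theorem mul_one_sub_indicator_typicalSet_le {p : ι → ℝ} (hp : ∀ i, 0 ≤ p i) (s : ℝ) {n : ℕ}
    (hn : 0 < n) {δ : ℝ} (hδ : 0 < δ) (j : Fin n → ι) :
    (∏ i, p (j i)) * (1 - (typicalSet n s δ).indicator 1 (∏ i, p (j i))) ≤
      (∏ i, p (j i)) * (∑ i, (-Real.logb 2 (p (j i)) - s)) ^ 2 / (n * δ) ^ 2 := by
  have hnonneg : 0 ≤ ∏ i, p (j i) := Finset.prod_nonneg fun i _ => hp _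
  rcases hnonneg.eq_or_lt with h0 | hpos
  · simp [← h0]
  rw [mul_div_assoc]
  refine mul_le_mul_of_nonneg_left ?_ hpos.le
  by_cases h : ∏ i, p (j i) ∈ typicalSet n s δ
  · simpa [h] using div_nonneg (sq_nonneg _) (sq_nonneg _)
  have hne : ∀ i, p (j i) ≠ 0 := fun i hi => hpos.ne' (Finset.prod_eq_zero (Finset.mem_univ i) hi)
  have hlog : -Real.logb 2 (∏ i, p (j i)) - n * s = ∑ i, (-Real.logb 2 (p (j i)) - s) := by
    rw [Real.logb_prod _ _ fun i _ => hne i]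
    simp
  rw [mem_typicalSet_iff hpos, hlog, not_le] at h
  have hnδ : 0 < n * δ := by positivity
  rw [Set.indicator_of_notMem (by rwa [mem_typicalSet_iff hpos, hlog, not_le]), sub_zero,
    one_le_div (by positivity), ← sq_abs (∑ i, _)]
  exact pow_le_pow_left₀ hnδ.le h.le 2

variable [Fintype ι]

theorem sum_prod_mul_mul {p g : ι → ℝ} (hp : ∑ i, p i = 1) (hg : ∑ i, p i * g i = 0) {n : ℕ}
    (a b : Fin n) : ∑ j : Fin n → ι, (∏ i, p (j i)) * (g (j a) * g (j b)) =
      if a = b then ∑ i, p i * g i ^ 2 else 0 := by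
  have hprod : ∀ j : Fin n → ι, (∏ i, p (j i)) * (g (j a) * g (j b)) =
      ∏ i, p (j i) * ((if i = a then g (j i) else 1) * (if i = b then g (j i) else 1)) := by
    intro j
    rw [Finset.prod_mul_distrib, Finset.prod_mul_distrib]
    simp
  have hsum := Finset.prod_univ_sum (fun _ : Fin n => (Finset.univ : Finset ι))
    (fun i k => p k * ((if i = a then g k else 1) * (if i = b then g k else 1)))
  rw [Fintype.piFinset_univ] at hsum
  simp only [hprod]
  rw [← hsum]
  split_ifs with h
  · subst h
    rw [Finset.prod_eq_single a]
    · simp [sq]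
    · intro i _ hi; simp [hi, hp]
    · simp
  · refine Finset.prod_eq_zero (Finset.mem_univ a) ?_
    simpa [h] using hg

theorem sum_prod_mul_sum_sq {p g : ι → ℝ} (hp : ∑ i, p i = 1) (hg : ∑ i, p i * g i = 0) (n : ℕ) :
    ∑ j : Fin n → ι, (∏ i, p (j i)) * (∑ i, g (j i)) ^ 2 = n * ∑ i, p i * g i ^ 2 := by
  calc ∑ j : Fin n → ι, (∏ i, p (j i)) * (∑ i, g (j i)) ^ 2
      = ∑ j : Fin n → ι, ∑ a, ∑ b, (∏ i, p (j i)) * (g (j a) * g (j b)) := by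
        simp only [sq, Finset.sum_mul_sum]
        simp only [Finset.mul_sum]
    _ = ∑ a, ∑ b, ∑ j : Fin n → ι, (∏ i, p (j i)) * (g (j a) * g (j b)) := by
        rw [Finset.sum_comm]
        exact Finset.sum_congr rfl fun a _ => Finset.sum_comm
    _ = n * ∑ i, p i * g i ^ 2 := by simp [sum_prod_mul_mul hp hg]

variable [DecidableEq ι]

theorem typicalProj_spectralHom (n : ℕ) (s δ : ℝ) (W : Matrix.unitaryGroup ι ℂ) (p : ι → ℝ) :
    typicalProj n s δ (spectralHom W p) =
      spectralHom W ((typicalSet n s δ).indicator 1 ∘ p) := by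
  classical
  rw [typicalProj, cfc_spectralHom]
  congr 1
  ext i
  simp [typicalSet, Set.indicator_apply]

theorem isStarProjection_typicalProj (n : ℕ) (s δ : ℝ) (σ : Matrix ι ι ℂ) :
    IsStarProjection (typicalProj n s δ σ) :=
  isStarProjection_cfc (fun t => by split_ifs <;> simp) σ

theorem typicalProj_le (n : ℕ) (s δ : ℝ) {σ : Matrix ι ι ℂ} (hσ : 0 ≤ σ) :
    typicalProj n s δ σ ≤ (2 : ℝ) ^ (n * (s + δ)) • σ := by
  obtain ⟨W, p, hp, rfl⟩ := exists_eq_spectralHom_nonneg hσ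
  rw [typicalProj_spectralHom, ← map_smul]
  exact spectralHom_mono W fun i => indicator_typicalSet_le (hp i) n s δ

theorem typicalProj_conj_le (n : ℕ) (s δ : ℝ) {σ : Matrix ι ι ℂ} (hσ : σ.IsHermitian) :
    typicalProj n s δ σ * σ * typicalProj n s δ σ ≤
      (2 : ℝ) ^ (-(n * (s - δ))) • (1 : Matrix ι ι ℂ) := by
  obtain ⟨W, p, rfl⟩ := exists_eq_spectralHom hσ
  rw [typicalProj_spectralHom, ← map_mul, ← map_mul, ← map_one (spectralHom W), ← map_smul]
  refine spectralHom_mono W fun i => ?_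
  by_cases h : p i ∈ typicalSet n s δ
  · simpa [h] using h.2
  · simpa [h] using Real.rpow_nonneg zero_le_two _

theorem rank_spectralHom (W : Matrix.unitaryGroup ι ℂ) (d : ι → ℝ) :
    (spectralHom W d).rank = Fintype.card {i // d i ≠ 0} := by
  have hW : IsUnit (W : Matrix ι ι ℂ).det :=
    (Matrix.isUnit_iff_isUnit_det _).1 (Unitary.toUnits W).isUnit
  rw [spectralHom_apply, Matrix.rank_mul_eq_left_of_isUnit_det,
    Matrix.rank_mul_eq_right_of_isUnit_det _ _ hW, Matrix.rank_diagonal]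
  · simp
  · simpa using hW

theorem rank_typicalProj_le (n : ℕ) (s δ : ℝ) {σ : Matrix ι ι ℂ} (hσ : 0 ≤ σ)
    (h1 : σ.trace = 1) : ((typicalProj n s δ σ).rank : ℝ) ≤ 2 ^ (n * (s + δ)) := by
  classical
  obtain ⟨W, p, hp, rfl⟩ := exists_eq_spectralHom_nonneg hσ
  have hp1 : ∑ i, p i = 1 := by rw [trace_spectralHom] at h1; exact_mod_cast h1
  rw [typicalProj_spectralHom, rank_spectralHom]
  calc (Fintype.card {i // ((typicalSet n s δ).indicator (1 : ℝ → ℝ) ∘ p) i ≠ 0} : ℝ)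
      = ∑ i, (typicalSet n s δ).indicator 1 (p i) := by
        simp [Fintype.card_subtype, Set.indicator_apply, Finset.sum_boole]
    _ ≤ ∑ i, 2 ^ (n * (s + δ)) * p i :=
        Finset.sum_le_sum fun i _ => indicator_typicalSet_le (hp i) n s δ
    _ = 2 ^ (n * (s + δ)) := by rw [← Finset.mul_sum, hp1, mul_one]

/-- The constant is the variance of the surprisal of the spectrum of `M`; the bound is Chebyshev's
inequality. -/
theorem exists_trace_mul_one_sub_typicalProj_le {M : Matrix ι ι ℂ} (hM : 0 ≤ M)
    (h1 : M.trace = 1) : ∃ C : ℝ, ∀ (n : ℕ) (δ : ℝ), 0 < n → 0 < δ →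
      (tensorPow n M * (1 - typicalProj n (entropy M) δ (tensorPow n M))).trace.re ≤
        C / (n * δ ^ 2) := by
  obtain ⟨W, p, hp, rfl⟩ := exists_eq_spectralHom_nonneg hM
  have hp1 : ∑ i, p i = 1 := by rw [trace_spectralHom] at h1; exact_mod_cast h1
  set s := entropy (spectralHom W p) with hs
  set g : ι → ℝ := fun i => -Real.logb 2 (p i) - s with hg
  have hpg : ∑ i, p i * g i = 0 := by
    have : ∀ i, p i * g i = Real.negMulLog (p i) / Real.log 2 - p i * s := fun i => by
      simp only [hg, Real.negMulLog, Real.logb]; ring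
    simp only [this, Finset.sum_sub_distrib, ← Finset.sum_div, ← Finset.sum_mul, hp1, hs,
      entropy_spectralHom, one_mul, sub_self]
  refine ⟨∑ i, p i * g i ^ 2, fun n δ hn hδ => ?_⟩
  rw [tensorPow_spectralHom, typicalProj_spectralHom, ← map_one (spectralHom _), ← map_sub,
    ← map_mul, trace_spectralHom, Complex.ofReal_re]
  calc ∑ j : Fin n → ι, (∏ i, p (j i)) * (1 - (typicalSet n s δ).indicator 1 (∏ i, p (j i)))
      ≤ ∑ j : Fin n → ι, (∏ i, p (j i)) * (∑ i, g (j i)) ^ 2 / (n * δ) ^ 2 :=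
        Finset.sum_le_sum fun j _ => mul_one_sub_indicator_typicalSet_le hp s hn hδ j
    _ = (∑ i, p i * g i ^ 2) / (n * δ ^ 2) := by
        rw [← Finset.sum_div, sum_prod_mul_sum_sq hp1 hpg]
        have : (n : ℝ) ≠ 0 := by positivity
        field_simp

end Typical

/-! ### Covariant pretty good measurements -/

section PrettyGood

variable {ι Y : Type*} [Fintype ι] [DecidableEq ι] [Fintype Y] {Λ : Y → Matrix ι ι ℂ}

theorem prettyGood_nonneg {y : Y} (hΛ : 0 ≤ Λ y) : 0 ≤ prettyGood Λ y :=
  IsSelfAdjoint.conjugate_nonneg hΛ (isHermitian_invSqrt _)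

theorem isStarProjection_sum_prettyGood (hΛ : 0 ≤ ∑ y, Λ y) :
    IsStarProjection (∑ y, prettyGood Λ y) := by
  simp only [prettyGood]
  rw [← Finset.sum_mul, ← Finset.mul_sum]
  exact isStarProjection_invSqrt_conj hΛ

theorem rank_prettyGood_le (Λ : Y → Matrix ι ι ℂ) (y : Y) : (prettyGood Λ y).rank ≤ (Λ y).rank :=
  (Matrix.rank_mul_le_left _ _).trans (Matrix.rank_mul_le_right _ _)

theorem one_sub_prettyGood_le [DecidableEq Y] (hΛ : ∀ y, 0 ≤ Λ y) {y : Y} (hy : Λ y ≤ 1) :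
    1 - prettyGood Λ y ≤ 2 • (1 - Λ y) + 4 • ∑ y' ∈ Finset.univ.erase y, Λ y' := by
  rw [prettyGood, ← Finset.add_sum_erase _ _ (Finset.mem_univ y)]
  exact one_sub_invSqrt_conj_le (hΛ y) hy (Finset.sum_nonneg fun y' _ => hΛ y')

end PrettyGood

section Covariant

variable {ι : Type*} [Fintype ι] [DecidableEq ι] {r : ℕ} {b : ι → Bits r}

theorem conj_conj_of_commute {R : Type*} [Semigroup R] {a d : R} (h : Commute a d) (x : R) :
    a * (d * x * d) * a = d * (a * x * a) * d := by
  simp only [mul_assoc, h.left_comm, h.eq]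

theorem prettyGood_phaseOp_conj {M : Matrix ι ι ℂ} {Λ : Bits r → Matrix ι ι ℂ}
    (hΛ : ∀ y, Λ y = phaseOp b y * M * phaseOp b y) (y : Bits r) :
    prettyGood Λ y = phaseOp b y * prettyGood Λ 0 * phaseOp b y := by
  have hT : Commute (∑ y', Λ y') (phaseOp b y) :=
    commute_phaseOp (fun p q hpq => by simp only [hΛ, sum_phaseOp_conj_apply, if_neg hpq]) y
  have h0 : Λ 0 = M := by rw [hΛ, phaseOp_zero, Matrix.one_mul, Matrix.mul_one]
  rw [prettyGood, prettyGood, h0, hΛ y]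
  exact conj_conj_of_commute (hT.cfc_real _) M

theorem trace_phaseOp_conj_mul_phaseOp_conj (y : Bits r) (A B : Matrix ι ι ℂ) :
    (phaseOp b y * A * phaseOp b y * (phaseOp b y * B * phaseOp b y)).trace = (A * B).trace := by
  rw [show phaseOp b y * A * phaseOp b y * (phaseOp b y * B * phaseOp b y) =
      phaseOp b y * A * (phaseOp b y * phaseOp b y) * (B * phaseOp b y) by
    simp only [Matrix.mul_assoc], phaseOp_mul_self, Matrix.mul_one, ← Matrix.mul_assoc,
    Matrix.trace_mul_comm, ← Matrix.mul_assoc, ← Matrix.mul_assoc, phaseOp_mul_self, Matrix.one_mul]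

variable {P N : Matrix ι ι ℂ}

/-- The operators `P Z^y N Z^y P`, of which the protocol uses the pretty good measurement. -/
def covariantFamily (b : ι → Bits r) (P N : Matrix ι ι ℂ) (y : Bits r) : Matrix ι ι ℂ :=
  P * (phaseOp b y * N * phaseOp b y) * P

theorem covariantFamily_zero (b : ι → Bits r) (P N : Matrix ι ι ℂ) :
    covariantFamily b P N 0 = P * N * P := by
  rw [covariantFamily, phaseOp_zero, Matrix.one_mul, Matrix.mul_one]

theorem covariantFamily_nonneg (hP : IsSelfAdjoint P) (hN : 0 ≤ N) (y : Bits r) :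
    0 ≤ covariantFamily b P N y :=
  hP.conjugate_nonneg (IsSelfAdjoint.conjugate_nonneg hN (isHermitian_phaseOp b y))

theorem rank_covariantFamily_zero_le : (covariantFamily b P N 0).rank ≤ N.rank := by
  rw [covariantFamily_zero]
  exact (Matrix.rank_mul_le_left _ _).trans (Matrix.rank_mul_le_right _ _)

theorem prettyGood_covariantFamily (hP : ∀ y, Commute P (phaseOp b y)) (y : Bits r) :
    prettyGood (covariantFamily b P N) y =
      phaseOp b y * prettyGood (covariantFamily b P N) 0 * phaseOp b y :=
  prettyGood_phaseOp_conj (fun y => conj_conj_of_commute (hP y) N) y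

theorem sum_trace_prettyGood_covariantFamily (hP : ∀ y, Commute P (phaseOp b y))
    (σ : Matrix ι ι ℂ) :
    (1 / 2 : ℝ) ^ r * ∑ y, (phaseOp b y * σ * phaseOp b y *
      prettyGood (covariantFamily b P N) y).trace.re =
      (σ * prettyGood (covariantFamily b P N) 0).trace.re := by
  have h (y : Bits r) : (phaseOp b y * σ * phaseOp b y *
      prettyGood (covariantFamily b P N) y).trace =
        (σ * prettyGood (covariantFamily b P N) 0).trace := by
    rw [prettyGood_covariantFamily hP, trace_phaseOp_conj_mul_phaseOp_conj]
  simp only [h, Finset.sum_const, Finset.card_univ, nsmul_eq_mul, ← mul_assoc]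
  simp [ZMod.card]

theorem one_sub_trace_prettyGood_le (hP : IsStarProjection P) (hN : IsStarProjection N)
    {σ : Matrix ι ι ℂ} (hσ : 0 ≤ σ) (h1 : σ.trace = 1) :
    1 - (σ * prettyGood (covariantFamily b P N) 0).trace.re ≤
      6 * (σ * (1 - P)).trace.re + 4 * (σ * (1 - N)).trace.re +
        4 * ∑ y ∈ Finset.univ.erase 0, (σ * covariantFamily b P N y).trace.re := by
  have hPN : covariantFamily b P N 0 ≤ 1 := by
    rw [covariantFamily_zero]
    refine (hP.isSelfAdjoint.conjugate_le_conjugate hN.le_one).trans ?_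
    rw [mul_one, hP.isIdempotentElem.eq]
    exact hP.le_one
  have hHN := one_sub_prettyGood_le (covariantFamily_nonneg hP.isSelfAdjoint hN.nonneg) hPN
  have hconj := nsmul_le_nsmul_right (one_sub_conj_le hP hN) 2
  rw [← covariantFamily_zero b] at hconj
  have h := trace_mul_re_mono hσ (hHN.trans (add_le_add_left hconj _))
  simp only [Matrix.mul_sub, Matrix.mul_add, mul_smul_comm, Matrix.mul_one, Finset.mul_sum,
    Matrix.trace_sub, Matrix.trace_add, Matrix.trace_smul, Matrix.trace_sum, Complex.sub_re,
    Complex.add_re, Complex.smul_re, Complex.re_sum, h1, Complex.one_re] at h ⊢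
  simp only [← Finset.mul_sum, nsmul_eq_mul, Nat.cast_ofNat] at h ⊢
  linarith

theorem sum_trace_mul_covariantFamily_le (hP : IsSelfAdjoint P) {σ : Matrix ι ι ℂ} (hσ : 0 ≤ σ)
    (h1 : σ.trace = 1) {s t : ℝ} (hs : 0 ≤ s) (hN : N ≤ s • σ)
    (ht : P * (∑ y, phaseOp b y * σ * phaseOp b y) * P ≤ t • (1 : Matrix ι ι ℂ)) :
    ∑ y, (σ * covariantFamily b P N y).trace.re ≤ s * t := by
  have hsum : ∑ y, covariantFamily b P N y ≤ (s * t) • (1 : Matrix ι ι ℂ) :=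
    calc ∑ y, covariantFamily b P N y
        ≤ ∑ y, P * (phaseOp b y * (s • σ) * phaseOp b y) * P :=
          Finset.sum_le_sum fun y _ => hP.conjugate_le_conjugate
            (IsSelfAdjoint.conjugate_le_conjugate hN (isHermitian_phaseOp b y))
      _ = s • (P * (∑ y, phaseOp b y * σ * phaseOp b y) * P) := by
          simp only [mul_smul_comm, smul_mul_assoc, Finset.mul_sum, Finset.sum_mul,
            Finset.smul_sum]
      _ ≤ s • t • (1 : Matrix ι ι ℂ) := smul_le_smul_of_nonneg_left ht hs
      _ = (s * t) • (1 : Matrix ι ι ℂ) := smul_smul _ _ _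
  have h := trace_mul_re_mono hσ hsum
  rwa [mul_smul_comm, Matrix.mul_one, Matrix.trace_smul, h1, Complex.smul_re, Complex.one_re,
    smul_eq_mul, mul_one, Finset.mul_sum, Matrix.trace_sum, Complex.re_sum] at h

theorem trace_sum_phaseOp_conj_mul {Q : Matrix ι ι ℂ} (hQ : ∀ y, Commute Q (phaseOp b y))
    (σ : Matrix ι ι ℂ) :
    ((∑ y, phaseOp b y * σ * phaseOp b y) * Q).trace = 2 ^ r * (σ * Q).trace := by
  have h (y : Bits r) : (phaseOp b y * σ * phaseOp b y * Q).trace = (σ * Q).trace := by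
    rw [← trace_phaseOp_conj_mul_phaseOp_conj y σ Q, ← (hQ y).eq, Matrix.mul_assoc Q,
      phaseOp_mul_self, Matrix.mul_one]
  rw [Finset.sum_mul, Matrix.trace_sum, Finset.sum_congr rfl fun y _ => h y]
  simp [ZMod.card]

end Covariant

/-! ### The states of the protocol -/

section CondState

variable {L K E : Type*} [Fintype L] [DecidableEq L] [Fintype E]

theorem condState_sharedKey (f : L → ℂ) (η : Matrix (L × K) E ℂ) (p q : L × K) :
    condState f (sharedKey η) p q = star (f p.1) * (η * ηᴴ) p q * f q.1 := by
  rw [condState, Matrix.of_apply, Fintype.sum_eq_single p.1, Fintype.sum_eq_single q.1,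
    ← Finset.sum_mul, ← Finset.mul_sum, Matrix.mul_apply]
  · simp [sharedKey]
  · intro a ha
    simp [sharedKey, ha]
  · intro a ha
    simp [sharedKey, ha]

theorem two_pow_smul_condState_xKet [Fintype K] [DecidableEq K] {n : ℕ} (b : L → Bits n)
    (y : Bits n) (η : Matrix (L × K) E ℂ) :
    (2 ^ n : ℂ) • condState (fun a => xKet y (b a)) (sharedKey η) =
      phaseOp (fun p => b p.1) y * (η * ηᴴ) * phaseOp (fun p => b p.1) y := by
  ext p q
  have hs : star (((√2 : ℝ) : ℂ)⁻¹ ^ n) = ((√2 : ℝ) : ℂ)⁻¹ ^ n := by simp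
  have h2 : (2 ^ n : ℂ) * (2 ^ n)⁻¹ = 1 := mul_inv_cancel₀ (by positivity)
  rw [Matrix.smul_apply, condState_sharedKey, phaseOp_conj_apply, xKet_eq, xKet_eq, star_mul',
    star_zPhase, hs, smul_eq_mul]
  linear_combination (zPhase y (b p.1) * (η * ηᴴ) p q * zPhase y (b q.1)) *
    (h2 + 2 ^ n * inv_sqrt_two_pow_mul_self n)

end CondState

section States

variable {S E : Type*}

/-- The amplitudes of the input state as a matrix from `E` to `BS`, as in `sharedKey`. -/
def inputMatrix (φ : ZMod 2 → S × E → ℂ) : Matrix (ZMod 2 × S) E ℂ :=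
  Matrix.of fun p e => φ p.1 (p.2, e) / (√2 : ℝ)

theorem inputState_eq_sharedKey (φ : ZMod 2 → S × E → ℂ) :
    inputState φ = sharedKey (inputMatrix φ) := by
  funext p
  simp only [inputState, sharedKey, inputMatrix, Matrix.of_apply]
  split_ifs with h
  · rw [h]
  · rfl

variable [Fintype E]

theorem ensemble_zero (φ : ZMod 2 → S × E → ℂ) :
    ensemble φ 0 = inputMatrix φ * (inputMatrix φ)ᴴ := by
  ext p q
  have h2 : (2 : ℂ) * 2⁻¹ = 1 := mul_inv_cancel₀ two_ne_zero
  have hs := inv_sqrt_two_pow_mul_self 1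
  rw [ensemble, inputState_eq_sharedKey, Matrix.smul_apply, condState_sharedKey, smul_eq_mul]
  simp only [xKetBit, zero_mul, ZMod.val_zero, pow_zero, pow_one, one_div, star_inv₀,
    RCLike.star_def, Complex.conj_ofReal] at hs ⊢
  linear_combination (inputMatrix φ * (inputMatrix φ)ᴴ) p q * (h2 + 2 * hs)

theorem ensemble_eq [Fintype S] [DecidableEq S] (φ : ZMod 2 → S × E → ℂ) (x : ZMod 2) :
    ensemble φ x = phaseOp (fun p (_ : Fin 1) => p.1) (fun _ => x) * ensemble φ 0 *
      phaseOp (fun p (_ : Fin 1) => p.1) (fun _ => x) := by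
  rw [ensemble_zero, ← two_pow_smul_condState_xKet (fun a (_ : Fin 1) => a), ensemble,
    inputState_eq_sharedKey, pow_one]
  simp [xKet]

theorem ensemble_nonneg [Finite S] (φ : ZMod 2 → S × E → ℂ) (x : ZMod 2) : 0 ≤ ensemble φ x := by
  classical
  have := Fintype.ofFinite S
  rw [ensemble_eq, ensemble_zero]
  exact IsSelfAdjoint.conjugate_nonneg
    (Matrix.nonneg_iff_posSemidef.2 (Matrix.posSemidef_self_mul_conjTranspose _))
    (isHermitian_phaseOp _ _)

theorem avgState_nonneg [Finite S] (φ : ZMod 2 → S × E → ℂ) : 0 ≤ avgState φ := by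
  classical
  have := Fintype.ofFinite S
  exact smul_nonneg (by norm_num [Complex.le_def])
    (Finset.sum_nonneg fun x _ => ensemble_nonneg φ x)

theorem avgState_apply [Finite S] (φ : ZMod 2 → S × E → ℂ) (p q : ZMod 2 × S) :
    avgState φ p q = if p.1 = q.1 then ensemble φ 0 p q else 0 := by
  classical
  have := Fintype.ofFinite S
  have h := sum_phaseOp_conj_apply (fun p (_ : Fin 1) => p.1) (ensemble φ 0) p q
  rw [← (Equiv.funUnique (Fin 1) (ZMod 2)).symm.sum_comp] at h
  rw [avgState, Matrix.smul_apply, Finset.sum_congr rfl fun x _ => ensemble_eq φ x]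
  refine (congrArg _ h).trans ?_
  simp only [funext_iff, forall_const, pow_one]
  split_ifs <;> simp

section Trace

variable [Fintype S] {φ : ZMod 2 → S × E → ℂ} (hφ : ∀ k, IsNormalized (φ k))

include hφ

theorem trace_inputMatrix : (inputMatrix φ * (inputMatrix φ)ᴴ).trace = 1 := by
  have hk (k : ZMod 2) : ∑ s, ∑ e, ‖inputMatrix φ (k, s) e‖ ^ 2 = 1 / 2 := by
    have h := hφ k
    rw [IsNormalized, Fintype.sum_prod_type] at h
    simp [inputMatrix, div_pow, ← Finset.sum_div, h]
  rw [Matrix.trace_mul_comm, trace_conjTranspose_mul_self, Fintype.sum_prod_type]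
  simp only [hk]
  simp [ZMod.card]

theorem trace_ensemble (x : ZMod 2) : (ensemble φ x).trace = 1 := by
  classical
  rw [ensemble_eq, Matrix.trace_mul_cycle, phaseOp_mul_self, Matrix.one_mul, ensemble_zero,
    trace_inputMatrix hφ]

theorem trace_avgState : (avgState φ).trace = 1 := by
  simp [avgState, Matrix.trace_sum, trace_ensemble hφ, ZMod.card]

end Trace

section Entropy

variable [Fintype S] [DecidableEq S] (φ : ZMod 2 → S × E → ℂ)

theorem entropy_ensemble (x : ZMod 2) : entropy (ensemble φ x) = entropy (ensemble φ 0) := by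
  have h := entropy_unitary_conj ⟨_, phaseOp_mem_unitaryGroup (fun p (_ : Fin 1) => p.1) fun _ => x⟩
    (IsSelfAdjoint.of_nonneg (ensemble_nonneg φ 0))
  rwa [(isHermitian_phaseOp _ _).eq, ← ensemble_eq] at h

theorem half_sum_entropy_ensemble :
    1 / 2 * ∑ x, entropy (ensemble φ x) = entropy (ensemble φ 0) := by
  simp [entropy_ensemble φ, ZMod.card]

theorem holevo_ensemble :
    holevo (ensemble φ) = entropy (avgState φ) - entropy (ensemble φ 0) := by
  rw [holevo, half_sum_entropy_ensemble, avgState]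

end Entropy

variable {n : ℕ}

/-- The bits in the register `B` of the basis vectors of `n` copies of `BS`. -/
def keyBits (j : Fin n → ZMod 2 × S) : Bits n := fun i => (j i).1

theorem tensorPow_avgState_apply [Finite S] (φ : ZMod 2 → S × E → ℂ) (j k : Fin n → ZMod 2 × S) :
    tensorPow n (avgState φ) j k =
      if keyBits j = keyBits k then tensorPow n (ensemble φ 0) j k else 0 := by
  simp only [tensorPow, Matrix.of_apply, avgState_apply]
  split_ifs with h
  · exact Finset.prod_congr rfl fun i _ => if_pos (congrFun h i)
  · obtain ⟨i, hi⟩ := Function.ne_iff.1 h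
    exact Finset.prod_eq_zero (Finset.mem_univ i) (if_neg hi)

theorem sum_phaseOp_conj_tensorPow_ensemble [Fintype S] [DecidableEq S]
    (φ : ZMod 2 → S × E → ℂ) :
    ∑ x : Bits n, phaseOp keyBits x * tensorPow n (ensemble φ 0) * phaseOp keyBits x =
      (2 : ℝ) ^ n • tensorPow n (avgState φ) := by
  ext j k
  rw [sum_phaseOp_conj_apply, Matrix.smul_apply, tensorPow_avgState_apply]
  split_ifs <;> simp

end States

/-! ### Overlaps of the codewords -/

section Overlap

variable {S E : Type*} [Fintype S] [DecidableEq S] [Fintype E]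

/-- Typical projection of the average state of `n` copies. -/
def avgTypical (φ : ZMod 2 → S × E → ℂ) (n : ℕ) (δ : ℝ) :
    Matrix (Fin n → ZMod 2 × S) (Fin n → ZMod 2 × S) ℂ :=
  typicalProj n (entropy (avgState φ)) δ (tensorPow n (avgState φ))

/-- Typical projection of the codeword state of the zero string. -/
def zeroTypical (φ : ZMod 2 → S × E → ℂ) (n : ℕ) (δ : ℝ) :
    Matrix (Fin n → ZMod 2 × S) (Fin n → ZMod 2 × S) ℂ :=
  typicalProj n (entropy (ensemble φ 0)) δ (tensorPow n (ensemble φ 0))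

/-- Overlap of the codeword state of the zero string with the typical subspace of the string `x`,
within the typical subspace of the average state. -/
def overlap (φ : ZMod 2 → S × E → ℂ) (n : ℕ) (δ : ℝ) (x : Bits n) : ℝ :=
  (tensorPow n (ensemble φ 0) *
    covariantFamily keyBits (avgTypical φ n δ) (zeroTypical φ n δ) x).trace.re

variable {n : ℕ} (φ : ZMod 2 → S × E → ℂ) (δ : ℝ)

theorem isStarProjection_avgTypical : IsStarProjection (avgTypical φ n δ) :=
  isStarProjection_typicalProj _ _ _ _

theorem isStarProjection_zeroTypical : IsStarProjection (zeroTypical φ n δ) :=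
  isStarProjection_typicalProj _ _ _ _

theorem commute_avgTypical_phaseOp (x : Bits n) :
    Commute (avgTypical φ n δ) (phaseOp keyBits x) :=
  (commute_phaseOp (fun j k h => by rw [tensorPow_avgState_apply, if_neg h]) x).cfc_real _

theorem overlap_nonneg (x : Bits n) : 0 ≤ overlap φ n δ x :=
  (Complex.le_def.1 (trace_mul_nonneg (tensorPow_nonneg n (ensemble_nonneg φ 0))
    (covariantFamily_nonneg (isStarProjection_avgTypical φ δ).isSelfAdjoint
      (isStarProjection_zeroTypical φ δ).nonneg x))).1

theorem trace_tensorPow_ensemble_mul_one_sub_avgTypical :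
    (tensorPow n (ensemble φ 0) * (1 - avgTypical φ n δ)).trace =
      (tensorPow n (avgState φ) * (1 - avgTypical φ n δ)).trace := by
  have h := trace_sum_phaseOp_conj_mul (fun x => (Commute.one_left _).sub_left
    (commute_avgTypical_phaseOp φ δ x)) (tensorPow n (ensemble φ 0))
  rw [sum_phaseOp_conj_tensorPow_ensemble, smul_mul_assoc, Matrix.trace_smul, Complex.real_smul,
    Complex.ofReal_pow, Complex.ofReal_ofNat] at h
  exact (mul_left_cancel₀ (by positivity) h).symm

variable {φ}

theorem sum_overlap_le (hφ : ∀ k, IsNormalized (φ k)) :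
    ∑ x : Bits n, overlap φ n δ x ≤ (2 : ℝ) ^ (n * (1 - holevo (ensemble φ) + 2 * δ)) := by
  have hω := tensorPow_nonneg n (ensemble_nonneg φ 0)
  have hρ := tensorPow_nonneg n (avgState_nonneg φ)
  have ht : avgTypical φ n δ *
      (∑ x, phaseOp keyBits x * tensorPow n (ensemble φ 0) * phaseOp keyBits x) *
      avgTypical φ n δ ≤ ((2 : ℝ) ^ n * (2 : ℝ) ^ (-(n * (entropy (avgState φ) - δ)))) •
        (1 : Matrix (Fin n → ZMod 2 × S) (Fin n → ZMod 2 × S) ℂ) := by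
    rw [sum_phaseOp_conj_tensorPow_ensemble, mul_smul_comm, smul_mul_assoc, mul_smul]
    exact smul_le_smul_of_nonneg_left (typicalProj_conj_le n _ δ (IsSelfAdjoint.of_nonneg hρ))
      (by positivity)
  refine (sum_trace_mul_covariantFamily_le (isStarProjection_avgTypical φ δ).isSelfAdjoint hω
    (by rw [trace_tensorPow, trace_ensemble hφ, one_pow]) (by positivity)
    (typicalProj_le n _ δ hω) ht).trans_eq ?_
  rw [← Real.rpow_natCast, ← Real.rpow_add two_pos, ← Real.rpow_add two_pos, holevo_ensemble]
  congr 1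
  ring

end Overlap

/-! ### The encoded registers -/

section Submatrix

variable {ι κ R : Type*} [Fintype ι] [Fintype κ]

theorem trace_submatrix_equiv [AddCommMonoid R] (e : κ ≃ ι) (M : Matrix ι ι R) :
    (M.submatrix e e).trace = M.trace :=
  e.sum_comp fun i => M i i

theorem trace_submatrix_mul_submatrix [NonUnitalNonAssocSemiring R] (e : κ ≃ ι)
    (A B : Matrix ι ι R) : (A.submatrix e e * B.submatrix e e).trace = (A * B).trace := by
  rw [Matrix.submatrix_mul_equiv, trace_submatrix_equiv]

theorem isStarProjection_submatrix (e : κ ≃ ι) {P : Matrix ι ι ℂ} (hP : IsStarProjection P) :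
    IsStarProjection (P.submatrix e e) :=
  ⟨by rw [IsIdempotentElem, Matrix.submatrix_mul_equiv, hP.isIdempotentElem.eq],
    Matrix.IsHermitian.submatrix hP.isSelfAdjoint e⟩

end Submatrix

theorem normalize_smul {ι : Type*} [Fintype ι] {v : ι → ℂ} (hv : IsNormalized v) {t : ℝ}
    (ht : 0 < t) : normalize (fun i => (t : ℂ) * v i) = v := by
  have hnorm : ∑ j, ‖(t : ℂ) * v j‖ ^ 2 = t ^ 2 := by
    simp only [norm_mul, mul_pow, Complex.norm_real, Real.norm_of_nonneg ht.le]
    rw [← Finset.mul_sum, hv, mul_one]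
  funext i
  rw [normalize, hnorm, Real.sqrt_sq ht.le, ← mul_assoc, ← Complex.ofReal_mul,
    inv_mul_cancel₀ ht.ne', Complex.ofReal_one, one_mul]

section Codeword

variable {n r m : ℕ} (c : Bits n ≃ₗ[ZMod 2] Bits r × Bits m)

/-- The string `x` with `x · k = y · ℓ` for `c k = (ℓ, m)`. -/
def codeword (y : Bits r) : Bits n := fun i => y ⬝ᵥ (c (Pi.single i 1)).1

theorem codeword_dotProduct (y : Bits r) (k : Bits n) : codeword c y ⬝ᵥ k = y ⬝ᵥ (c k).1 := by
  conv_rhs => rw [← (Pi.basisFun (ZMod 2) (Fin n)).sum_repr k]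
  rw [map_sum, Prod.fst_sum, dotProduct_sum, dotProduct]
  refine Finset.sum_congr rfl fun i _ => ?_
  rw [map_smul, Prod.smul_fst, dotProduct_smul, Pi.basisFun_apply, Pi.basisFun_repr, codeword,
    smul_eq_mul, mul_comm]

theorem codeword_injective : Function.Injective (codeword c) := by
  intro y y' h
  ext j
  have hy := codeword_dotProduct c y (c.symm (Pi.single j 1, 0))
  have hy' := codeword_dotProduct c y' (c.symm (Pi.single j 1, 0))
  rw [h] at hy
  simpa using hy.symm.trans hy'

theorem codeword_zero : codeword c 0 = 0 := by
  ext i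
  simp [codeword]

theorem dotProduct_codeword_eq_zero (y : Bits r) (i : Fin m) :
    c.symm (0, Pi.single i 1) ⬝ᵥ codeword c y = 0 := by
  rw [dotProduct_comm, codeword_dotProduct]
  simp

end Codeword

section Registers

variable {S E : Type*} {n r m : ℕ}

/-- The encoded registers `B₁ B₂ S` as `n` copies of `BS`. -/
def regEquiv (S : Type*) (c : Bits n ≃ₗ[ZMod 2] Bits r × Bits m) :
    Bits r × Bits m × (Fin n → S) ≃ (Fin n → ZMod 2 × S) where
  toFun p i := (c.symm (p.1, p.2.1) i, p.2.2 i)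
  invFun j := ((c (keyBits j)).1, (c (keyBits j)).2, fun i => (j i).2)
  left_inv p := by
    have hp : c (keyBits fun i => (c.symm (p.1, p.2.1) i, p.2.2 i)) = (p.1, p.2.1) :=
      c.apply_symm_apply _
    simp only [hp]
  right_inv j := by
    simp only [Prod.mk.eta, LinearEquiv.symm_apply_apply, keyBits]

theorem phaseOp_fst_eq_submatrix [DecidableEq S] (c : Bits n ≃ₗ[ZMod 2] Bits r × Bits m)
    (y : Bits r) :
    phaseOp Prod.fst y =
      (phaseOp keyBits (codeword c y)).submatrix (regEquiv S c) (regEquiv S c) := by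
  rw [phaseOp, phaseOp, Matrix.submatrix_diagonal_equiv]
  congr 1
  funext p
  have hp : c (keyBits (regEquiv S c p)) = (p.1, p.2.1) := c.apply_symm_apply _
  rw [Function.comp_apply, zPhase_eq, zPhase_eq, codeword_dotProduct, hp]

theorem covariantFamily_submatrix [Fintype S] [DecidableEq S]
    (c : Bits n ≃ₗ[ZMod 2] Bits r × Bits m)
    (P N : Matrix (Fin n → ZMod 2 × S) (Fin n → ZMod 2 × S) ℂ) (y : Bits r) :
    covariantFamily Prod.fst (P.submatrix (regEquiv S c) (regEquiv S c))
        (N.submatrix (regEquiv S c) (regEquiv S c)) y =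
      (covariantFamily keyBits P N (codeword c y)).submatrix (regEquiv S c) (regEquiv S c) := by
  simp only [covariantFamily, phaseOp_fst_eq_submatrix c, Matrix.submatrix_mul_equiv]

/-- The amplitudes of the state after the announcement as a matrix from `Eⁿ` to `B₁B₂Sⁿ`, as in
`sharedKey`; they depend neither on the announcement nor on the phases `Z^h` correcting it. -/
def codeVec (φ : ZMod 2 → S × E → ℂ) (c : Bits n ≃ₗ[ZMod 2] Bits r × Bits m) :
    Matrix (Bits r × Bits m × (Fin n → S)) (Fin n → E) ℂ :=
  (tensorPow n (inputMatrix φ)).submatrix (regEquiv S c) id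

theorem codeVec_mul_conjTranspose [Fintype E] (φ : ZMod 2 → S × E → ℂ)
    (c : Bits n ≃ₗ[ZMod 2] Bits r × Bits m) :
    codeVec φ c * (codeVec φ c)ᴴ =
      (tensorPow n (ensemble φ 0)).submatrix (regEquiv S c) (regEquiv S c) := by
  rw [ensemble_zero, tensorPow_mul, ← conjTranspose_tensorPow, codeVec,
    Matrix.conjTranspose_submatrix]
  rfl

theorem inputPow_apply (φ : ZMod 2 → S × E → ℂ) (k k' : Bits n) (s : Fin n → S) (e : Fin n → E) :
    inputPow φ n (k, k', s, e) =
      if k = k' then tensorPow n (inputMatrix φ) (fun i => (k' i, s i)) e else 0 := by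
  simp only [inputPow, inputState_eq_sharedKey, sharedKey, tensorPow, Matrix.of_apply]
  split_ifs with h
  · exact Finset.prod_congr rfl fun i _ => if_pos (congrFun h i)
  · obtain ⟨i, hi⟩ := Function.ne_iff.1 h
    exact Finset.prod_eq_zero (Finset.mem_univ i) (if_neg hi)

variable [Fintype S] [Fintype E] {φ : ZMod 2 → S × E → ℂ} (hφ : ∀ k, IsNormalized (φ k))
  (c : Bits n ≃ₗ[ZMod 2] Bits r × Bits m)

include hφ

theorem trace_codeVec : ((codeVec φ c)ᴴ * codeVec φ c).trace = 1 := by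
  rw [Matrix.trace_mul_comm, codeVec_mul_conjTranspose, trace_submatrix_equiv, trace_tensorPow,
    trace_ensemble hφ, one_pow]

theorem isNormalized_sharedKey_codeVec : IsNormalized (sharedKey (codeVec φ c)) := by
  rw [IsNormalized, sum_norm_sq_sharedKey, trace_codeVec hφ, Complex.one_re]

theorem announced_eq_sharedKey (h : Bits m) : announced φ c h = sharedKey (codeVec φ c) := by
  rw [announced, ← normalize_smul (isNormalized_sharedKey_codeVec hφ c)
    (t := (√2)⁻¹ ^ m) (by positivity)]
  congr 1
  funext ⟨a, b, ⟨b₂, s⟩, e⟩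
  rw [Fintype.sum_eq_single b₂ fun a₂ ha => by simp [inputPow_apply, ha]]
  have hη : tensorPow n (inputMatrix φ) (fun i => (c.symm (b, b₂) i, s i)) e =
      codeVec φ c (b, b₂, s) e := rfl
  have hstar : star (((√2 : ℝ) : ℂ)⁻¹ ^ m) = ((√2 : ℝ) : ℂ)⁻¹ ^ m := by simp
  simp only [inputPow_apply, sharedKey, EmbeddingLike.apply_eq_iff_eq, Prod.mk.injEq, and_true,
    xKet_eq, star_mul', star_zPhase, hstar, hη]
  split_ifs
  · push_cast
    linear_combination ((√2 : ℝ) : ℂ)⁻¹ ^ m * codeVec φ c (b, b₂, s) e * zPhase_mul_self h b₂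
  · simp

theorem codeState_eq [DecidableEq S] (h : Bits m) (y : Bits r) :
    codeState φ c h y =
      phaseOp Prod.fst y * (codeVec φ c * (codeVec φ c)ᴴ) * phaseOp Prod.fst y := by
  rw [codeState, announced_eq_sharedKey hφ]
  exact two_pow_smul_condState_xKet id y _

theorem bobPGM_eq [DecidableEq S] (h : Bits m) (δ : ℝ) :
    bobPGM φ c h δ = prettyGood (covariantFamily Prod.fst
      ((avgTypical φ n δ).submatrix (regEquiv S c) (regEquiv S c))
      ((zeroTypical φ n δ).submatrix (regEquiv S c) (regEquiv S c))) := by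
  have hω := Matrix.isHermitian_iff_isSelfAdjoint.2
    (IsSelfAdjoint.of_nonneg (tensorPow_nonneg n (ensemble_nonneg φ 0)))
  have hρ := Matrix.isHermitian_iff_isSelfAdjoint.2
    (IsSelfAdjoint.of_nonneg (tensorPow_nonneg n (avgState_nonneg φ)))
  have havg : avgPow φ c =
      (tensorPow n (avgState φ)).submatrix (regEquiv S c) (regEquiv S c) := rfl
  rw [bobPGM]
  congr 1
  funext y
  rw [covariantFamily, half_sum_entropy_ensemble, typicalProj, typicalProj, codeState_eq hφ,
    havg, cfc_submatrix _ _ hρ, codeVec_mul_conjTranspose,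
    cfc_phaseOp_conj _ _ _ (hω.submatrix _), cfc_submatrix _ _ hω]
  rfl

end Registers

/-! ### Bob's measurement -/

section BobPGM

variable {S E : Type*} [Fintype S] [DecidableEq S] [Fintype E] {n r m : ℕ}

/-- Part of the error of Bob's measurement that is due to the weight of the states outside their
typical subspaces; the coefficients are those of `one_sub_trace_prettyGood_le`. -/
def atypicalWeight (φ : ZMod 2 → S × E → ℂ) (n : ℕ) (δ : ℝ) : ℝ :=
  6 * (tensorPow n (avgState φ) * (1 - avgTypical φ n δ)).trace.re +
    4 * (tensorPow n (ensemble φ 0) * (1 - zeroTypical φ n δ)).trace.re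

theorem atypicalWeight_nonneg (φ : ZMod 2 → S × E → ℂ) (n : ℕ) (δ : ℝ) :
    0 ≤ atypicalWeight φ n δ := by
  have hP := (Complex.le_def.1 (trace_mul_nonneg (tensorPow_nonneg n (avgState_nonneg φ))
    (isStarProjection_avgTypical (n := n) φ δ).one_sub.nonneg)).1
  have hN := (Complex.le_def.1 (trace_mul_nonneg (tensorPow_nonneg n (ensemble_nonneg φ 0))
    (isStarProjection_zeroTypical (n := n) φ δ).one_sub.nonneg)).1
  exact add_nonneg (mul_nonneg (by norm_num) hP) (mul_nonneg (by norm_num) hN)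

theorem commute_submatrix_avgTypical_phaseOp (φ : ZMod 2 → S × E → ℂ) (δ : ℝ)
    (c : Bits n ≃ₗ[ZMod 2] Bits r × Bits m) (y : Bits r) :
    Commute ((avgTypical φ n δ).submatrix (regEquiv S c) (regEquiv S c))
      (phaseOp Prod.fst y) := by
  rw [phaseOp_fst_eq_submatrix c, Commute, SemiconjBy, Matrix.submatrix_mul_equiv,
    Matrix.submatrix_mul_equiv, (commute_avgTypical_phaseOp φ δ _).eq]

theorem covariantFamily_submatrix_nonneg (φ : ZMod 2 → S × E → ℂ) (δ : ℝ)
    (c : Bits n ≃ₗ[ZMod 2] Bits r × Bits m) (y : Bits r) :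
    0 ≤ covariantFamily Prod.fst ((avgTypical φ n δ).submatrix (regEquiv S c) (regEquiv S c))
      ((zeroTypical φ n δ).submatrix (regEquiv S c) (regEquiv S c)) y :=
  covariantFamily_nonneg
    (isStarProjection_submatrix (regEquiv S c) (isStarProjection_avgTypical φ δ)).isSelfAdjoint
    (isStarProjection_submatrix (regEquiv S c) (isStarProjection_zeroTypical φ δ)).nonneg y

variable {φ : ZMod 2 → S × E → ℂ} (hφ : ∀ k, IsNormalized (φ k))
  (c : Bits n ≃ₗ[ZMod 2] Bits r × Bits m) (h : Bits m) (δ : ℝ)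

include hφ

theorem sum_trace_codeState_mul_bobPGM :
    (1 / 2 : ℝ) ^ r * ∑ y, (codeState φ c h y * bobPGM φ c h δ y).trace.re =
      (codeVec φ c * (codeVec φ c)ᴴ * bobPGM φ c h δ 0).trace.re := by
  simp only [codeState_eq hφ, bobPGM_eq hφ]
  exact sum_trace_prettyGood_covariantFamily (commute_submatrix_avgTypical_phaseOp φ δ c) _

theorem one_sub_trace_mul_bobPGM_zero_le :
    1 - (codeVec φ c * (codeVec φ c)ᴴ * bobPGM φ c h δ 0).trace.re ≤
      atypicalWeight φ n δ + 4 * ∑ y ∈ Finset.univ.erase 0, overlap φ n δ (codeword c y) := by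
  set g := regEquiv S c
  have hσ : 0 ≤ codeVec φ c * (codeVec φ c)ᴴ :=
    Matrix.nonneg_iff_posSemidef.2 (Matrix.posSemidef_self_mul_conjTranspose _)
  have hσ1 : (codeVec φ c * (codeVec φ c)ᴴ).trace = 1 := by
    rw [Matrix.trace_mul_comm, trace_codeVec hφ]
  have htr (M : Matrix (Fin n → ZMod 2 × S) (Fin n → ZMod 2 × S) ℂ) :
      (codeVec φ c * (codeVec φ c)ᴴ * M.submatrix g g).trace =
        (tensorPow n (ensemble φ 0) * M).trace := by
    rw [codeVec_mul_conjTranspose, trace_submatrix_mul_submatrix]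
  have hsub (M : Matrix (Fin n → ZMod 2 × S) (Fin n → ZMod 2 × S) ℂ) :
      1 - M.submatrix g g = (1 - M).submatrix g g := by
    rw [← Matrix.submatrix_one_equiv g]
    rfl
  have herr := one_sub_trace_prettyGood_le (b := Prod.fst)
    (isStarProjection_submatrix g (isStarProjection_avgTypical φ δ))
    (isStarProjection_submatrix g (isStarProjection_zeroTypical φ δ)) hσ hσ1
  simp only [hsub, htr, covariantFamily_submatrix, g,
    trace_tensorPow_ensemble_mul_one_sub_avgTypical] at herr
  rw [bobPGM_eq hφ]
  exact herr

theorem isStarProjection_sum_bobPGM : IsStarProjection (∑ y, bobPGM φ c h δ y) := by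
  rw [bobPGM_eq hφ]
  exact isStarProjection_sum_prettyGood (Finset.sum_nonneg fun y _ =>
    covariantFamily_submatrix_nonneg φ δ c y)

theorem exists_untwists_bobPGM
    (hrank : (zeroTypical φ n δ).rank ≤ Fintype.card (Bits m × (Fin n → S))) :
    ∃ V, Untwists V (bobPGM φ c h δ) := by
  have hQ := isStarProjection_sum_bobPGM hφ c h δ
  rw [bobPGM_eq hφ] at hQ ⊢
  refine exists_untwists
    (prettyGood_covariantFamily (commute_submatrix_avgTypical_phaseOp φ δ c))
    (prettyGood_nonneg (covariantFamily_submatrix_nonneg φ δ c 0)) hQ ?_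
  refine ((rank_prettyGood_le _ _).trans rank_covariantFamily_zero_le).trans ?_
  rwa [Matrix.rank_submatrix]

end BobPGM

/-! ### Good hashes -/

theorem exists_isClosePrivate_and_isEpsPrivate {r : ℕ} {K E : Type*} [Fintype K] [DecidableEq K]
    [Fintype E] [DecidableEq E] {V : Bits r → Matrix K K ℂ}
    {F : Bits r → Matrix (Bits r × K) (Bits r × K) ℂ} (hV : Untwists V F)
    (hQ : IsStarProjection (∑ y, F y)) {η : Matrix (Bits r × K) E ℂ}
    (hη : (ηᴴ * η).trace = 1) {e ε : ℝ} (he0 : 0 < e) (he : e < 1 / 2)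
    (hF : 1 - e ≤ (η * ηᴴ * F 0).trace.re) (hε : 2 * √e ≤ ε) :
    (∃ ξ, IsNormalized ξ ∧ IsClosePrivate ε V ξ (sharedKey η)) ∧
      IsEpsPrivate ε (sharedKey η) := by
  have hη1 : (ηᴴ * η).trace.re = 1 := by rw [hη, Complex.one_re]
  have hΨ : IsNormalized (sharedKey η) := by rw [IsNormalized, sum_norm_sq_sharedKey, hη1]
  obtain ⟨ξ, hξ, hγ, hclose⟩ := exists_close_privateState hV hQ hη1 he hF
  have hD : 0 < 2 * √e := by positivity
  replace hclose := hclose.trans_eq (b := 4 * e) (c := (2 * √e) ^ 2) (by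
    rw [mul_pow, Real.sq_sqrt he0.le]
    norm_num)
  obtain ⟨ρE, hρE, hρE1, hkey⟩ := isEpsPrivate_of_close hV.1 hξ hΨ hγ hD hclose
  exact ⟨⟨ξ, hξ, (traceNorm_proj_sub_proj_le hΨ hγ hD hclose).trans (by linarith)⟩,
    ρE, hρE, hρE1, hkey.trans (by linarith)⟩

section GoodHash

variable {S E : Type*} [Fintype S] [DecidableEq S] [Fintype E] {n r m : ℕ}
  {φ : ZMod 2 → S × E → ℂ} {δ ε e : ℝ} {u : Fin m → Bits n}

theorem sum_overlap_codeword_le (c : Bits n ≃ₗ[ZMod 2] Bits r × Bits m)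
    (hc : ∀ i, c.symm (0, Pi.single i 1) = u i) :
    ∑ y ∈ Finset.univ.erase 0, overlap φ n δ (codeword c y) ≤
      ∑ x with x ≠ 0 ∧ ∀ i, u i ⬝ᵥ x = 0, overlap φ n δ x := by
  rw [← Finset.sum_image (g := codeword c) (codeword_injective c).injOn]
  refine Finset.sum_le_sum_of_subset_of_nonneg (fun x hx => ?_) fun x _ _ => overlap_nonneg φ δ x
  obtain ⟨y, hy, rfl⟩ := Finset.mem_image.1 hx
  refine Finset.mem_filter.2 ⟨Finset.mem_univ _, fun h0 => ?_, fun i => ?_⟩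
  · exact Finset.ne_of_mem_erase hy (codeword_injective c (h0.trans (codeword_zero c).symm))
  · rw [← hc i, dotProduct_codeword_eq_zero]

theorem goodHash_of_sum_overlap_le [DecidableEq E] (hφ : ∀ k, IsNormalized (φ k))
    (hrank : (zeroTypical φ n δ).rank ≤ Fintype.card (Bits m × (Fin n → S)))
    (hover : ∀ c : Bits n ≃ₗ[ZMod 2] Bits r × Bits m, (∀ i, c.symm (0, Pi.single i 1) = u i) →
      atypicalWeight φ n δ +
        4 * ∑ y ∈ Finset.univ.erase 0, overlap φ n δ (codeword c y) ≤ e)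
    (he0 : 0 < e) (he : e < 1 / 2) (heε : e ≤ ε) (hε : 2 * √e ≤ ε) : GoodHash φ r δ ε u := by
  intro c hc h
  have hF : 1 - e ≤ (codeVec φ c * (codeVec φ c)ᴴ * bobPGM φ c h δ 0).trace.re := by
    linarith [one_sub_trace_mul_bobPGM_zero_le hφ c h δ, hover c hc]
  obtain ⟨V, hV⟩ := exists_untwists_bobPGM hφ c h δ hrank
  obtain ⟨⟨ξ, hξ, hclose⟩, hkey⟩ := exists_isClosePrivate_and_isEpsPrivate hV
    (isStarProjection_sum_bobPGM hφ c h δ) (trace_codeVec hφ c) he0 he hF hε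
  rw [announced_eq_sharedKey hφ, sum_trace_codeState_mul_bobPGM hφ]
  exact ⟨by linarith, ⟨V, ξ, hV, hξ, hclose⟩, hkey⟩

end GoodHash

/-! ### Random linear hashes -/

section Counting

open Finset

theorem card_linearIndependent_forall_eq_zero_mul_le {K V : Type*} [Field K] [Finite K]
    [AddCommGroup V] [Module K V] [FiniteDimensional K V] {f : Module.Dual K V} (hf : f ≠ 0)
    (m : ℕ) :
    Nat.card {u : Fin m → V // LinearIndependent K u ∧ ∀ i, f (u i) = 0} * Nat.card K ^ m ≤
      Nat.card {u : Fin m → V // LinearIndependent K u} := by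
  have := Fintype.ofFinite K
  have := Module.finite_of_finite K (M := V)
  have hdim := Module.Dual.finrank_ker_add_one_of_ne_zero hf
  have hker : Nat.card {u : Fin m → V // LinearIndependent K u ∧ ∀ i, f (u i) = 0} ≤
      Nat.card {v : Fin m → f.ker // LinearIndependent K v} := by
    refine Nat.card_le_card_of_injective (fun u => ⟨fun i => ⟨u.1 i, u.2.2 i⟩,
      LinearIndependent.of_comp f.ker.subtype u.2.1⟩) fun u u' h => Subtype.ext (funext fun i => ?_)
    exact Subtype.ext_iff.1 (congrFun (Subtype.ext_iff.1 h) i)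
  refine (Nat.mul_le_mul_right _ hker).trans ?_
  rcases le_or_gt m (Module.finrank K f.ker) with hm | hm
  · rw [card_linearIndependent hm, card_linearIndependent (by omega), Nat.card_eq_fintype_card,
      ← Fin.prod_const m (Fintype.card K), ← prod_mul_distrib]
    refine prod_le_prod' fun i _ => ?_
    rw [Nat.sub_mul, ← pow_succ, ← pow_succ, hdim]
    exact Nat.sub_le_sub_left (Nat.pow_le_pow_right Fintype.card_pos i.1.le_succ) _
  · have : IsEmpty {v : Fin m → f.ker // LinearIndependent K v} :=
      ⟨fun v => hm.not_ge (by simpa using v.2.fintype_card_le_finrank)⟩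
    simp

theorem card_linearIndependent_dotProduct_eq_zero_mul_le {K ι : Type*} [Field K] [Finite K]
    [Fintype ι] {x : ι → K} (hx : x ≠ 0) (m : ℕ) :
    Nat.card {u : Fin m → ι → K // LinearIndependent K u ∧ ∀ i, u i ⬝ᵥ x = 0} * Nat.card K ^ m ≤
      Nat.card {u : Fin m → ι → K // LinearIndependent K u} := by
  classical
  refine card_linearIndependent_forall_eq_zero_mul_le (f := (dotProductBilin K K).flip x)
    (fun h => hx (funext fun i => ?_)) m
  simpa using LinearMap.congr_fun h (Pi.single i 1)

theorem one_sub_mul_card_le_card_filter_sum_le {Ω X : Type*} [Fintype X] (L : Finset Ω)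
    (R : Ω → X → Prop) [∀ u, DecidablePred (R u)] {t : X → ℝ} (ht : ∀ x, 0 ≤ t x) {q z : ℝ}
    (hz : 0 < z) (hR : ∀ x, #{u ∈ L | R u x} * q ≤ #L) (hq : 0 < q)
    (hsum : ∑ x, t x ≤ q * z ^ 2) :
    (1 - z) * #L ≤ #{u ∈ L | ∑ x with R u x, t x ≤ z} := by
  have hmean : ∑ u ∈ L, ∑ x with R u x, t x ≤ z ^ 2 * #L :=
    calc ∑ u ∈ L, ∑ x with R u x, t x
        = ∑ x, t x * #{u ∈ L | R u x} := by
          simp only [sum_filter]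
          rw [sum_comm]
          simp only [← sum_filter, sum_const, nsmul_eq_mul, mul_comm]
      _ ≤ ∑ x, t x * (#L / q) :=
          sum_le_sum fun x _ => mul_le_mul_of_nonneg_left ((le_div_iff₀ hq).2 (hR x)) (ht x)
      _ = (∑ x, t x) * (#L / q) := (sum_mul _ _ _).symm
      _ ≤ q * z ^ 2 * (#L / q) := by gcongr
      _ = z ^ 2 * #L := by field_simp
  have hmarkov : #{u ∈ L | ¬ ∑ x with R u x, t x ≤ z} * z ≤ ∑ u ∈ L, ∑ x with R u x, t x := by
    rw [← nsmul_eq_mul]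
    exact (card_nsmul_le_sum _ _ _ fun u hu => (not_le.1 (mem_filter.1 hu).2).le).trans
      (sum_le_sum_of_subset_of_nonneg (filter_subset _ _)
        fun u _ _ => sum_nonneg fun x _ => ht x)
  have hbad : (#{u ∈ L | ¬ ∑ x with R u x, t x ≤ z} : ℝ) ≤ z * #L :=
    le_of_mul_le_mul_right (by linarith) hz
  have hsplit : (#{u ∈ L | ∑ x with R u x, t x ≤ z} : ℝ) +
      #{u ∈ L | ¬ ∑ x with R u x, t x ≤ z} = #L := by
    exact_mod_cast card_filter_add_card_filter_not (s := L) (fun u => ∑ x with R u x, t x ≤ z)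
  linarith

theorem one_sub_mul_card_linearIndependent_le {K ι : Type*} [Field K] [Fintype K] [Fintype ι]
    [DecidableEq ι] [DecidableEq K] {m : ℕ} {t : (ι → K) → ℝ} (ht : ∀ x, 0 ≤ t x) {z : ℝ}
    (hz : 0 < z) (hsum : ∑ x, t x ≤ (Fintype.card K : ℝ) ^ m * z ^ 2) :
    (1 - z) * Nat.card {u : Fin m → ι → K // LinearIndependent K u} ≤
      Nat.card {u : Fin m → ι → K // LinearIndependent K u ∧
        ∑ x with x ≠ 0 ∧ ∀ i, u i ⬝ᵥ x = 0, t x ≤ z} := by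
  classical
  have h := one_sub_mul_card_le_card_filter_sum_le
    ({u | LinearIndependent K u} : Finset (Fin m → ι → K))
    (fun u x => x ≠ 0 ∧ ∀ i, u i ⬝ᵥ x = 0) ht hz (fun x => ?_)
    (pow_pos (Nat.cast_pos.2 Fintype.card_pos) m) hsum
  · simpa only [Nat.card_eq_fintype_card, Fintype.card_subtype, filter_filter] using h
  · rcases eq_or_ne x 0 with rfl | hx
    · simp
    · have hx' := card_linearIndependent_dotProduct_eq_zero_mul_le hx m
      simp only [Nat.card_eq_fintype_card, Fintype.card_subtype] at hx'
      simp only [filter_filter, hx, ne_eq, not_false_eq_true, true_and]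
      exact_mod_cast hx'

end Counting

/-! ### Performance of a random hash -/

section Rate

theorem card_pi_bits_prod (S : Type*) [Fintype S] {n r : ℕ} (hrn : r ≤ n) :
    Fintype.card (Fin n → ZMod 2 × S) =
      Fintype.card (Bits (n - r) × (Fin n → S)) * 2 ^ r := by
  simp only [Fintype.card_prod, Fintype.card_fun, ZMod.card, Fintype.card_fin]
  rw [mul_pow, mul_right_comm, ← pow_add, Nat.sub_add_cancel hrn]

variable {S E : Type*} [Fintype S] [DecidableEq S] [Fintype E] {n r : ℕ}
  {φ : ZMod 2 → S × E → ℂ} {δ : ℝ}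

theorem rank_zeroTypical_mul_le (hφ : ∀ k, IsNormalized (φ k)) (hδ : 0 ≤ δ)
    (hr : r ≤ n * (holevo (ensemble φ) - 3 * δ)) :
    ((zeroTypical φ n δ).rank : ℝ) * 2 ^ r ≤ Fintype.card (Fin n → ZMod 2 × S) := by
  have hS : Nonempty (ZMod 2 × S) := by
    by_contra hS
    rw [not_nonempty_iff] at hS
    simpa [Matrix.trace] using trace_ensemble hφ 0
  have hn : (0 : ℝ) ≤ n := n.cast_nonneg
  have hexp : n * (entropy (ensemble φ 0) + δ) + r ≤
      Real.logb 2 (Fintype.card (ZMod 2 × S)) * n := by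
    rw [holevo_ensemble] at hr
    nlinarith [mul_le_mul_of_nonneg_left
      (entropy_le_logb_card (avgState_nonneg φ) (trace_avgState hφ)) hn, mul_nonneg hn hδ]
  calc ((zeroTypical φ n δ).rank : ℝ) * 2 ^ r
      ≤ 2 ^ (n * (entropy (ensemble φ 0) + δ)) * 2 ^ r := by
        gcongr
        exact rank_typicalProj_le n _ δ (tensorPow_nonneg n (ensemble_nonneg φ 0))
          (by rw [trace_tensorPow, trace_ensemble hφ, one_pow])
    _ = 2 ^ (n * (entropy (ensemble φ 0) + δ) + r) := by
        rw [Real.rpow_add two_pos, Real.rpow_natCast]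
    _ ≤ 2 ^ (Real.logb 2 (Fintype.card (ZMod 2 × S)) * n) :=
        Real.rpow_le_rpow_of_exponent_le one_le_two hexp
    _ = Fintype.card (Fin n → ZMod 2 × S) := by
        rw [Real.rpow_mul zero_le_two, Real.rpow_logb two_pos (by norm_num)
          (Nat.cast_pos.2 Fintype.card_pos), Real.rpow_natCast, Fintype.card_fun,
          Fintype.card_fin, Nat.cast_pow]

theorem rank_zeroTypical_le (hφ : ∀ k, IsNormalized (φ k)) (hδ : 0 ≤ δ) (hrn : r ≤ n)
    (hr : r ≤ n * (holevo (ensemble φ) - 3 * δ) ∨ r = 0) :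
    (zeroTypical φ n δ).rank ≤ Fintype.card (Bits (n - r) × (Fin n → S)) := by
  refine Nat.le_of_mul_le_mul_right (c := 2 ^ r) ?_ (by positivity)
  rw [← card_pi_bits_prod S hrn]
  rcases hr with hr | rfl
  · exact_mod_cast rank_zeroTypical_mul_le hφ hδ hr
  · simpa using Matrix.rank_le_card_width (zeroTypical φ n δ)

theorem sum_overlap_le_mul_sq (hφ : ∀ k, IsNormalized (φ k)) (hrn : r ≤ n)
    (hr : r ≤ n * (holevo (ensemble φ) - 3 * δ)) :
    ∑ x : Bits n, overlap φ n δ x ≤ 2 ^ (n - r) * ((2 : ℝ) ^ (-(n * δ / 2))) ^ 2 := by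
  refine (sum_overlap_le δ hφ).trans ?_
  rw [← Real.rpow_natCast 2 (n - r), ← Real.rpow_mul_natCast zero_le_two,
    ← Real.rpow_add two_pos]
  refine Real.rpow_le_rpow_of_exponent_le one_le_two ?_
  push_cast [hrn]
  linarith

/-- Error of Bob's measurement when his overlaps with the other codewords add up to at most
`2 ^ (-n δ / 2)`. -/
def codeError (φ : ZMod 2 → S × E → ℂ) (n : ℕ) (δ : ℝ) : ℝ :=
  atypicalWeight φ n δ + 4 * 2 ^ (-(n * δ / 2))

/-- The `ε` for which a random hash is `ε`-good with probability at least `1 - ε`: the terms bound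
the error of the measurement, the distance to a private state, and the probability that the
overlaps with the other codewords exceed `2 ^ (-n δ / 2)`. -/
def hashError (φ : ZMod 2 → S × E → ℂ) (n : ℕ) (δ : ℝ) : ℝ :=
  codeError φ n δ + 2 * √(codeError φ n δ) + 2 ^ (-(n * δ / 2))

theorem codeError_pos (φ : ZMod 2 → S × E → ℂ) (n : ℕ) (δ : ℝ) : 0 < codeError φ n δ :=
  add_pos_of_nonneg_of_pos (atypicalWeight_nonneg φ n δ) (by positivity)

variable [DecidableEq E]

theorem goodHash_hashError {m : ℕ} {u : Fin m → Bits n} (hφ : ∀ k, IsNormalized (φ k))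
    (hrank : (zeroTypical φ n δ).rank ≤ Fintype.card (Bits m × (Fin n → S)))
    (hover : ∀ c : Bits n ≃ₗ[ZMod 2] Bits r × Bits m, (∀ i, c.symm (0, Pi.single i 1) = u i) →
      ∑ y ∈ Finset.univ.erase 0, overlap φ n δ (codeword c y) ≤ 2 ^ (-(n * δ / 2)))
    (herr : hashError φ n δ < 1) : GoodHash φ r δ (hashError φ n δ) u := by
  have he := codeError_pos φ n δ
  have hz : (0 : ℝ) < 2 ^ (-(n * δ / 2)) := by positivity
  have hs := Real.sqrt_nonneg (codeError φ n δ)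
  have hsq := Real.sq_sqrt he.le
  rw [hashError] at herr
  refine goodHash_of_sum_overlap_le (e := codeError φ n δ) hφ hrank
    (fun c hc => add_le_add_right (mul_le_mul_of_nonneg_left (hover c hc) zero_le_four) _) he
    (by nlinarith) ?_ ?_ <;> rw [hashError] <;> linarith

theorem card_goodHash_ge (hφ : ∀ k, IsNormalized (φ k)) (hδ : 0 ≤ δ) (hrn : r ≤ n)
    (hr : r ≤ n * (holevo (ensemble φ) - 3 * δ) ∨ r = 0) :
    (1 - hashError φ n δ) *
        Nat.card {u : Fin (n - r) → Bits n // LinearIndependent (ZMod 2) u} ≤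
      Nat.card {u : Fin (n - r) → Bits n // LinearIndependent (ZMod 2) u ∧
        GoodHash φ r δ (hashError φ n δ) u} := by
  have hrank := rank_zeroTypical_le hφ hδ hrn hr
  rcases le_or_gt 1 (hashError φ n δ) with herr | herr
  · exact (mul_nonpos_of_nonpos_of_nonneg (by linarith) (Nat.cast_nonneg _)).trans
      (Nat.cast_nonneg _)
  have hz : (2 : ℝ) ^ (-(n * δ / 2)) ≤ hashError φ n δ := by
    rw [hashError]
    linarith [codeError_pos φ n δ, Real.sqrt_nonneg (codeError φ n δ)]
  have hz0 : (0 : ℝ) < 2 ^ (-(n * δ / 2)) := by positivity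
  rcases hr with hr | rfl
  · refine (mul_le_mul_of_nonneg_right (sub_le_sub_left hz 1) (Nat.cast_nonneg _)).trans
      ((one_sub_mul_card_linearIndependent_le (overlap_nonneg φ δ) hz0 ?_).trans
        (Nat.cast_le.2 (Nat.card_mono (Set.toFinite _) fun u hu => ⟨hu.1, ?_⟩)))
    · simpa only [ZMod.card, Nat.cast_ofNat] using sum_overlap_le_mul_sq hφ hrn hr
    · exact goodHash_hashError hφ hrank
        (fun c hc => (sum_overlap_codeword_le c hc).trans hu.2) herr
  · have hgood (u : Fin (n - 0) → Bits n) : GoodHash φ 0 δ (hashError φ n δ) u :=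
      goodHash_hashError hφ hrank (fun c _ => by
        rw [Finset.sum_eq_zero fun y hy =>
          absurd (Subsingleton.elim y 0) (Finset.ne_of_mem_erase hy)]
        exact hz0.le) herr
    simp only [hgood, and_true]
    exact mul_le_of_le_one_left (Nat.cast_nonneg _) (by linarith)

end Rate

/-! ### Asymptotics -/

section Asymptotics

open Filter Topology

theorem tendsto_succ_rpow_neg {a : ℝ} (ha : 0 < a) :
    Tendsto (fun n : ℕ => ((n : ℝ) + 1) ^ (-a)) atTop (𝓝 0) :=
  (tendsto_rpow_neg_atTop ha).comp
    (tendsto_atTop_add_const_right _ _ tendsto_natCast_atTop_atTop)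

theorem tendsto_mul_succ_rpow_neg_atTop {a : ℝ} (ha : a < 1) :
    Tendsto (fun n : ℕ => (n : ℝ) * ((n : ℝ) + 1) ^ (-a)) atTop atTop := by
  have h : Tendsto (fun n : ℕ => ((n : ℝ) + 1) ^ (1 - a) / 2) atTop atTop :=
    ((tendsto_rpow_atTop (sub_pos.2 ha)).comp
      (tendsto_atTop_add_const_right _ _ tendsto_natCast_atTop_atTop)).atTop_div_const two_pos
  refine tendsto_atTop_mono' _ ?_ h
  filter_upwards [eventually_ge_atTop 1] with n hn
  have hn1 : (1 : ℝ) ≤ n := by exact_mod_cast hn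
  rw [sub_eq_add_neg, Real.rpow_add (by positivity), Real.rpow_one, mul_div_right_comm]
  gcongr
  linarith

theorem tendsto_floor_div {χ : ℝ} (h0 : 0 ≤ χ) {δ : ℕ → ℝ} (hδ0 : ∀ n, 0 ≤ δ n)
    (hδ : Tendsto δ atTop (𝓝 0)) :
    Tendsto (fun n : ℕ => (⌊(n : ℝ) * (χ - 3 * δ n)⌋₊ : ℝ) / n) atTop (𝓝 χ) := by
  have hlow : Tendsto (fun n : ℕ => χ - 3 * δ n - 1 / (n : ℝ)) atTop (𝓝 χ) := by
    simpa using ((tendsto_const_nhds (x := χ)).sub (hδ.const_mul 3)).sub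
      (tendsto_one_div_atTop_nhds_zero_nat (𝕜 := ℝ))
  refine tendsto_of_tendsto_of_tendsto_of_le_of_le' hlow tendsto_const_nhds ?_ ?_
  all_goals
    filter_upwards [eventually_gt_atTop 0] with n hn
    have hn' : (0 : ℝ) < n := by exact_mod_cast hn
  · rw [le_div_iff₀ hn', sub_mul, one_div_mul_cancel hn'.ne', mul_comm]
    exact (Nat.sub_one_lt_floor _).le
  · rw [div_le_iff₀ hn']
    exact (Nat.cast_le.2 (Nat.floor_mono (by nlinarith [hδ0 n]))).trans
      (Nat.floor_le (by positivity))

variable {S E : Type*} [Fintype S] [DecidableEq S] [Fintype E] {φ : ZMod 2 → S × E → ℂ}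
  {δ : ℕ → ℝ}

theorem tendsto_atypicalWeight (hφ : ∀ k, IsNormalized (φ k)) (hδ0 : ∀ n, 0 < δ n)
    (hδ : Tendsto (fun n : ℕ => n * δ n ^ 2) atTop atTop) :
    Tendsto (fun n => atypicalWeight φ n (δ n)) atTop (𝓝 0) := by
  obtain ⟨C, hC⟩ := exists_trace_mul_one_sub_typicalProj_le (avgState_nonneg φ)
    (trace_avgState hφ)
  obtain ⟨C', hC'⟩ := exists_trace_mul_one_sub_typicalProj_le (ensemble_nonneg φ 0)
    (trace_ensemble hφ 0)
  have hbound : Tendsto (fun n : ℕ => 6 * (C / (n * δ n ^ 2)) + 4 * (C' / (n * δ n ^ 2)))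
      atTop (𝓝 0) := by
    simpa using ((hδ.const_div_atTop C).const_mul 6).add ((hδ.const_div_atTop C').const_mul 4)
  refine tendsto_of_tendsto_of_tendsto_of_le_of_le' tendsto_const_nhds hbound
    (Eventually.of_forall fun n => atypicalWeight_nonneg φ n (δ n)) ?_
  filter_upwards [eventually_gt_atTop 0] with n hn
  exact add_le_add (mul_le_mul_of_nonneg_left (hC n (δ n) hn (hδ0 n)) (by norm_num))
    (mul_le_mul_of_nonneg_left (hC' n (δ n) hn (hδ0 n)) (by norm_num))

theorem tendsto_hashError (hφ : ∀ k, IsNormalized (φ k)) (hδ0 : ∀ n, 0 < δ n)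
    (hδ : Tendsto δ atTop (𝓝 0)) (hδ2 : Tendsto (fun n : ℕ => n * δ n ^ 2) atTop atTop) :
    Tendsto (fun n => hashError φ n (δ n)) atTop (𝓝 0) := by
  have hnδ : Tendsto (fun n : ℕ => n * δ n) atTop atTop := by
    refine tendsto_atTop_mono' _ ?_ hδ2
    filter_upwards [hδ.eventually_le_const one_pos] with n hn
    exact mul_le_mul_of_nonneg_left (pow_le_of_le_one (hδ0 n).le hn two_ne_zero) n.cast_nonneg
  have hz : Tendsto (fun n : ℕ => (2 : ℝ) ^ (-(n * δ n / 2))) atTop (𝓝 0) :=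
    (tendsto_rpow_atBot_of_base_gt_one 2 one_lt_two).comp
      (tendsto_neg_atTop_atBot.comp (hnδ.atTop_div_const two_pos))
  have hcode : Tendsto (fun n => codeError φ n (δ n)) atTop (𝓝 0) := by
    simpa [codeError] using (tendsto_atypicalWeight hφ hδ0 hδ2).add (hz.const_mul 4)
  simpa [hashError] using (hcode.add (hcode.sqrt.const_mul 2)).add hz

end Asymptotics

end PrivateState

end

open PrivateState Filter Topology

theorem theorem4 {S E : Type*} [Fintype S] [DecidableEq S] [Fintype E] [DecidableEq E]
    (φ : ZMod 2 → S × E → ℂ) (hφ : ∀ k, PrivateState.IsNormalized (φ k)) :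
    ∃ (r : ℕ → ℕ) (δ ε : ℕ → ℝ),
      (∀ n, r n ≤ n) ∧
      Filter.Tendsto (fun n => (r n : ℝ) / n) Filter.atTop
        (nhds (PrivateState.holevo (PrivateState.ensemble φ))) ∧
      (∀ n, 0 < δ n) ∧ Filter.Tendsto δ Filter.atTop (nhds 0) ∧
      Filter.Tendsto ε Filter.atTop (nhds 0) ∧
      ∀ n, (1 - ε n) *
          (Nat.card {u : Fin (n - r n) → PrivateState.Bits n // LinearIndependent (ZMod 2) u} : ℝ) ≤
        (Nat.card {u : Fin (n - r n) → PrivateState.Bits n // LinearIndependent (ZMod 2) u ∧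
          PrivateState.GoodHash φ (r n) (δ n) (ε n) u} : ℝ) := by
  have hχ0 : 0 ≤ holevo (ensemble φ) := holevo_nonneg (ensemble_nonneg φ)
  have hχ1 : holevo (ensemble φ) ≤ 1 := holevo_le_one (ensemble_nonneg φ) (trace_ensemble hφ)
  set δ : ℕ → ℝ := fun n => ((n : ℝ) + 1) ^ (-(1 / 4 : ℝ)) with hδdef
  have hδ0 (n : ℕ) : 0 < δ n := by positivity
  have hδ : Tendsto δ atTop (𝓝 0) := tendsto_succ_rpow_neg (by norm_num)
  have hδ2 : Tendsto (fun n : ℕ => n * δ n ^ 2) atTop atTop := by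
    refine (tendsto_mul_succ_rpow_neg_atTop one_half_lt_one).congr fun n => ?_
    rw [hδdef, ← Real.rpow_mul_natCast (by positivity)]
    norm_num
  have hrn (n : ℕ) : ⌊n * (holevo (ensemble φ) - 3 * δ n)⌋₊ ≤ n :=
    Nat.floor_le_of_le (mul_le_of_le_one_right n.cast_nonneg (by linarith [hδ0 n]))
  refine ⟨fun n => ⌊n * (holevo (ensemble φ) - 3 * δ n)⌋₊, δ, fun n => hashError φ n (δ n), hrn,
    tendsto_floor_div hχ0 (fun n => (hδ0 n).le) hδ, hδ0, hδ, tendsto_hashError hφ hδ0 hδ hδ2,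
    fun n => card_goodHash_ge hφ (hδ0 n).le (hrn n) ?_⟩
  exact (le_total 0 _).imp Nat.floor_le Nat.floor_of_nonpos
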